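/- Let $f : \mathbb R/2\pi\mathbb Z \to \mathbb C$ be continuously differentiable, with Fourier coefficients $\hat f(k) = \frac{1}{2\pi}\int_{-\pi}^{\pi} f(x)e^{-ikx}\,dx$, $k\in\mathbb Z$. Let $M$ be a random unitary $n\times n$ matrix distributed according to the normalized Haar measure on $U(n)$, let $e^{i\theta_1},\dots,e^{i\theta_n}$ be its eigenvalues, listed with multiplicity, let $S_n(f)=\sum_{j=1}^n f(\theta_j)$, and let $C_{\ell,n}(f)$ be the $\ell$-th cumulant of $S_n(f)$, that is, $C_{\ell,n}(f)=\frac{d^\ell}{dz^\ell}\log E\,e^{zS_n(f)}\big|_{z=0}$. Then for every integer $\ell\ge 1$ there is a constant $\mathrm{const}_\ell$, depending only on $\ell$, such that for all $n$ and all such $f$ $$\Bigl|\,C_{\ell,n}(f)-\sum_{k_1+\dots+k_\ell=0}\hat f(k_1)\cdots\hat f(k_\ell)\,w_n(k_1,\dots,k_\ell)\Bigr|\;\le\;\mathrm{const}_\ell\sum_{\substack{k_1+\dots+k_\ell=0\\ |k_1|+\dots+|k_\ell|>n}}|k_1|\,|\hat f(k_1)|\cdots|\hat f(k_\ell)|,$$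 where $$w_n(k_1,\dots,k_\ell)=\sum_{m=1}^{\ell}\frac{(-1)^{m-1}}{m}\sum_{\substack{\ell_1+\dots+\ell_m=\ell\\ \ell_1,\dots,\ell_m\ge1}}\frac{\ell!}{\ell_1!\cdots\ell_m!}\Bigl(n-\max\bigl(0,\,P_{\ell_1},\,P_{\ell_1+\ell_2},\dots,P_{\ell_1+\dots+\ell_{m-1}}\bigr)-\max\bigl(0,\,-P_{\ell_1},\,-P_{\ell_1+\ell_2},\dots,-P_{\ell_1+\dots+\ell_{m-1}}\bigr)\Bigr)$$ with $P_s=\sum_{i=1}^{s}k_i$, and both sums over $(k_1,\dots,k_\ell)\in\mathbb Z^\ell$ converge absolutely. -/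

import Mathlib

open MeasureTheory

namespace UnitaryCumulant

noncomputable section

instance fact_two_pi_pos : Fact (0 < 2 * Real.pi) := ⟨Real.two_pi_pos⟩

/-- The unitary group `U(n)`. -/
abbrev U (n : ℕ) : Type := Matrix.unitaryGroup (Fin n) ℂ

instance compactSpace_U (n : ℕ) : CompactSpace (U n) := by
  refine isCompact_iff_compactSpace.mp ?_
  have hK : IsCompact (Set.univ.pi fun _ : Fin n => Set.univ.pi fun _ : Fin n =>
      Metric.closedBall (0 : ℂ) 1) :=
    isCompact_univ_pi fun _ => isCompact_univ_pi fun _ => isCompact_closedBall _ _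
  refine IsCompact.of_isClosed_subset hK ?_ ?_
  · have : (Matrix.unitaryGroup (Fin n) ℂ : Set (Matrix (Fin n) (Fin n) ℂ)) =
        {A | A * star A = 1} := by
      ext A
      exact Matrix.mem_unitaryGroup_iff
    rw [this]
    exact isClosed_eq (by fun_prop) continuous_const
  · intro A hA i _ j _
    simpa using entry_norm_bound_of_unitary hA i j

instance measurableSpace_U (n : ℕ) : MeasurableSpace (U n) := borel _

instance borelSpace_U (n : ℕ) : BorelSpace (U n) := ⟨rfl⟩

/-- The Haar measure on `U(n)`, normalized to total mass `1`. -/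
def haarU (n : ℕ) : Measure (U n) := Measure.haarMeasure ⊤

/-- The linear statistic `S_n(f) = ∑ j, f (θ_j)`, where the `exp (i θ_j)` are the eigenvalues of
the unitary matrix `M`, listed with multiplicity. The test function lives on `ℝ / 2πℤ`, so the
choice of the eigenangles modulo `2π` is immaterial. -/
def linStat (n : ℕ) (f : AddCircle (2 * Real.pi) → ℂ) (M : U n) : ℂ :=
  ((M : Matrix (Fin n) (Fin n) ℂ).charpoly.roots.map
    fun z : ℂ => f ((z.arg : ℝ) : AddCircle (2 * Real.pi))).sum

/-- The `ℓ`-th cumulant of a bounded (complex-valued) random variable `X`: the `ℓ`-th derivative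
at `z = 0` of `log E[exp (z X)]`. -/
def cumulant {Ω : Type*} [MeasurableSpace Ω] (μ : Measure Ω) (X : Ω → ℂ) (ℓ : ℕ) : ℂ :=
  iteratedDeriv ℓ (fun z : ℂ => Complex.log (∫ ω, Complex.exp (z * X ω) ∂μ)) 0

/-- The partial sum `k_1 + ⋯ + k_s`. -/
def partialSum {ℓ : ℕ} (k : Fin ℓ → ℤ) (s : ℕ) : ℤ :=
  ∑ i ∈ Finset.univ.filter (fun i : Fin ℓ => (i : ℕ) < s), k i

/-- For a composition `ℓ = ℓ_1 + ⋯ + ℓ_m`, the maximum of `0` and the partial sums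
`k_1 + ⋯ + k_{ℓ_1 + ⋯ + ℓ_j}` for `1 ≤ j ≤ m - 1`. -/
def maxPartial {ℓ : ℕ} (c : Composition ℓ) (k : Fin ℓ → ℤ) : ℤ :=
  (Finset.Ico 1 c.length).fold max 0 fun j => partialSum k (c.sizeUpTo j)

/-- The weight of `k = (k_1, …, k_ℓ)`: the sum over `m` and over the compositions
`ℓ = ℓ_1 + ⋯ + ℓ_m` into `m` positive parts. -/
def weight (n : ℕ) {ℓ : ℕ} (k : Fin ℓ → ℤ) : ℝ :=
  ∑ m ∈ Finset.Icc 1 ℓ, (-1 : ℝ) ^ (m - 1) / (m : ℝ) *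
    ∑ c : Composition ℓ with c.length = m,
      (ℓ.factorial : ℝ) / (∏ i : Fin c.length, ((c.blocksFun i).factorial : ℝ)) *
        ((n : ℝ) - (maxPartial c k : ℝ) - (maxPartial c (fun i => -k i) : ℝ))

end

end UnitaryCumulant

/-! By the Heine–Szegő identity (`integral_prodStat`), E exp(z S_n(f)) = det T_n(exp(zf)), where
T_n(g) is the Toeplitz matrix with entries ĝ(i-j). Write T_n(exp(zf)) = 1 + B(z) with B(0) = 0. The
ℓ-th derivative at 0 of log det = tr log(1 + B) sees only the first ℓ terms of the logarithmic
series (`iteratedDeriv_log_det`), so C_{ℓ,n} is a combination, over compositions of ℓ, of traces of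
products T_n(f^{ℓ_1})⋯T_n(f^{ℓ_m}) (`cumulant_linStat`).

Expand each factor in Fourier series. T_n of a character is a truncated shift, and the trace of a
product of such shifts counts the starting points whose closed path stays in {0,…,n-1}: this is the
positive part of n - max(0, P) - max(0, -P) (`trace_list_prod_toeplitz_fourier`). Without the
positive part one gets exactly w_n. When the k_i sum to zero, 2|P_s| ≤ ∑|k_i|, so the positive part
matters only if ∑|k_i| > n, and then it changes a count by at most ∑|k_i|. Symmetry in the k_i turns
∑|k_i| into ℓ|k_1|.

Heine–Szegő is obtained without Weyl's integration formula. Let h_k be the complete homogeneous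
functions of the eigenvalues. A Jacobi–Trudi type formula (`det_homMatrix`) writes ∏ p(z_j) as a
determinant in the h_k, so it is enough that the integral of conj(det M)^N ∏ h_{κ_i}(M) vanishes
unless every κ_i equals N. Now h_k(M) is a nonzero multiple of the mean of (v*Mv)^k over random unit
vectors v (`sphereMoment_eq`); this reduces the claim to products of powers of bilinear forms in M,
where Haar invariance and the unitarian trick (`evalEntries_eq_zero`) give it.

Convergence: for f of class C¹, ∑ k²|f̂(k)|² and hence ∑|f̂(k)| are finite, and the constraint ∑k_i
= 0 frees one coordinate (`summable_abs_mul_prod_hyperplane`). -/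

namespace UnitaryCumulant


/-! ### The unitarian trick for polynomials in matrix entries -/

section PolynomialIdentity

open scoped Matrix.Norms.L2Operator
open NormedSpace

variable {ι : Type*}

/-- Evaluation of a polynomial in the entries of a matrix. -/
noncomputable def evalEntries (p : MvPolynomial (ι × ι) ℂ) (A : Matrix ι ι ℂ) : ℂ :=
  MvPolynomial.eval (fun x : ι × ι => A x.1 x.2) p

variable [Fintype ι] [DecidableEq ι]

set_option linter.unusedSectionVars false in
theorem differentiable_entry (i j : ι) : Differentiable ℂ fun A : Matrix ι ι ℂ => A i j :=
  (LinearMap.toContinuousLinearMap (Matrix.entryLinearMap ℂ ℂ i j)).differentiable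

theorem differentiable_evalEntries (p : MvPolynomial (ι × ι) ℂ) :
    Differentiable ℂ (evalEntries p) := by
  unfold evalEntries
  induction p using MvPolynomial.induction_on with
  | C a => simp
  | add p q hp hq =>
    simp only [map_add]
    exact hp.add hq
  | mul_X p x hp =>
    simp only [map_mul, MvPolynomial.eval_X]
    exact hp.mul (differentiable_entry x.1 x.2)

/-- Identity theorem: the real line accumulates at 0. -/
theorem eq_zero_of_real_eq_zero {f : ℂ → ℂ} (hf : Differentiable ℂ f)
    (h : ∀ t : ℝ, f t = 0) (z : ℂ) : f z = 0 := by
  have hA : AnalyticOnNhd ℂ f Set.univ := fun z _ => hf.analyticAt z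
  have h0 : AnalyticOnNhd ℂ (fun _ : ℂ => (0 : ℂ)) Set.univ := fun z _ => analyticAt_const
  refine congrFun (hA.eq_of_frequently_eq (z₀ := 0) h0 ?_) z
  have ht : Filter.Tendsto (fun t : ℝ => (t : ℂ)) (nhdsWithin 0 {0}ᶜ) (nhdsWithin 0 {0}ᶜ) := by
    refine tendsto_nhdsWithin_of_tendsto_nhds_of_eventually_within _ ?_ ?_
    · exact (Complex.continuous_ofReal.tendsto' 0 0 (by simp)).mono_left nhdsWithin_le_nhds
    · filter_upwards [self_mem_nhdsWithin] with t ht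
      simpa using ht
  exact ht.frequently (Filter.Eventually.of_forall h).frequently

/-- Write X = X₁ + iX₂ with X₁, X₂ skew-Hermitian. For real t the matrix exp(X₁ + tX₂) is unitary,
and the resulting entire function of t can be evaluated at t = i. -/
theorem evalEntries_exp_eq_zero {p : MvPolynomial (ι × ι) ℂ}
    (hp : ∀ U ∈ Matrix.unitaryGroup ι ℂ, evalEntries p U = 0) (X : Matrix ι ι ℂ) :
    evalEntries p (exp X) = 0 := by
  set X₁ : Matrix ι ι ℂ := (1 / 2 : ℂ) • (X - star X) with hX₁
  set X₂ : Matrix ι ι ℂ := (-Complex.I / 2 : ℂ) • (X + star X) with hX₂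
  have hX : X = X₁ + Complex.I • X₂ := by
    rw [hX₁, hX₂, smul_smul]
    have : Complex.I * (-Complex.I / 2) = 1 / 2 := by
      rw [mul_div_assoc', mul_neg, Complex.I_mul_I]; norm_num
    rw [this, ← smul_add]
    have h2 : X - star X + (X + star X) = (2 : ℂ) • X := by rw [two_smul]; abel
    rw [h2, smul_smul]; norm_num
  have hf : Differentiable ℂ fun z : ℂ => evalEntries p (exp (X₁ + z • X₂)) := by
    refine (differentiable_evalEntries p).comp ?_
    have he : Differentiable ℂ (exp : Matrix ι ι ℂ → Matrix ι ι ℂ) :=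
      fun A => (exp_analytic (𝕂 := ℂ) A).differentiableAt
    exact he.comp (by fun_prop)
  rw [hX]
  refine eq_zero_of_real_eq_zero hf (fun t => hp _ ?_) Complex.I
  let : NormedAlgebra ℚ (Matrix ι ι ℂ) := NormedAlgebra.restrictScalars ℚ ℂ _
  refine exp_mem_unitary_of_mem_skewAdjoint ?_
  rw [skewAdjoint.mem_iff, star_add, star_smul, hX₁, hX₂, star_smul, star_smul]
  simp only [star_sub, star_add, star_star, RCLike.star_def, map_div₀, map_neg, Complex.conj_I,
    Complex.conj_ofReal, map_one, map_ofNat]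
  module

/-- The exponential covers a neighbourhood of 1, its derivative at 0 being the identity; from there
the vanishing continues analytically along the complex line through 1 and A. -/
theorem evalEntries_eq_zero {p : MvPolynomial (ι × ι) ℂ}
    (hp : ∀ U ∈ Matrix.unitaryGroup ι ℂ, evalEntries p U = 0) (A : Matrix ι ι ℂ) :
    evalEntries p A = 0 := by
  have hnear : ∀ᶠ B in nhds (1 : Matrix ι ι ℂ), evalEntries p B = 0 := by
    have hmap := (hasStrictFDerivAt_exp_zero (𝕂 := ℂ) (𝔸 := Matrix ι ι ℂ)).map_nhds_eq_of_surj
      (LinearMap.range_eq_top.mpr fun x => ⟨x, rfl⟩)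
    rw [exp_zero] at hmap
    rw [← hmap, Filter.eventually_map]
    exact Filter.Eventually.of_forall fun X => evalEntries_exp_eq_zero hp X
  have hd : Differentiable ℂ fun t : ℂ => evalEntries p (1 + t • (A - 1)) :=
    (differentiable_evalEntries p).comp (by fun_prop)
  have hz : (fun t : ℂ => evalEntries p (1 + t • (A - 1))) =ᶠ[nhds 0] fun _ => 0 := by
    have hc : Filter.Tendsto (fun t : ℂ => (1 : Matrix ι ι ℂ) + t • (A - 1)) (nhds 0) (nhds 1) :=
      Continuous.tendsto' (by fun_prop) 0 1 (by simp)
    exact hc.eventually hnear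
  have hA : AnalyticOnNhd ℂ (fun t : ℂ => evalEntries p (1 + t • (A - 1))) Set.univ :=
    fun z _ => hd.analyticAt z
  have h0 : AnalyticOnNhd ℂ (fun _ : ℂ => (0 : ℂ)) Set.univ := fun z _ => analyticAt_const
  have := congrFun (hA.eq_of_eventuallyEq h0 hz) 1
  simpa using this

end PolynomialIdentity

/-! ### Integration over U(n) -/

instance haarU_isHaar (n : ℕ) : (haarU n).IsHaarMeasure := by unfold haarU; infer_instance

instance haarU_isProb (n : ℕ) : IsProbabilityMeasure (haarU n) := ⟨by
  have := Measure.haarMeasure_self (K₀ := (⊤ : TopologicalSpace.PositiveCompacts (U n)))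
  simpa [haarU] using this⟩

instance secondCountable_U (n : ℕ) : SecondCountableTopology (U n) :=
  haveI : SecondCountableTopology (Matrix (Fin n) (Fin n) ℂ) :=
    inferInstanceAs (SecondCountableTopology (Fin n → Fin n → ℂ))
  Topology.IsEmbedding.subtypeVal.secondCountableTopology

theorem continuous_entry {n : ℕ} (i j : Fin n) :
    Continuous fun M : U n => (M : Matrix (Fin n) (Fin n) ℂ) i j :=
  (continuous_apply_apply i j).comp continuous_subtype_val

theorem integrable_of_continuous {n : ℕ} {f : U n → ℂ} (hf : Continuous f) :
    Integrable f (haarU n) :=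
  hf.integrable_of_hasCompactSupport (HasCompactSupport.of_compactSpace f)

/-- A polynomial expression in the entries of `A`, with coefficients depending continuously on `M`,
becomes a polynomial in the entries of `A` after integration over `M`. -/
theorem exists_evalEntries_eq_integral {n : ℕ} (P : MvPolynomial (Fin n × Fin n) C(U n, ℂ)) :
    ∃ p : MvPolynomial (Fin n × Fin n) ℂ, ∀ A : Matrix (Fin n) (Fin n) ℂ,
      ∫ M, MvPolynomial.eval (fun x => ContinuousMap.const _ (A x.1 x.2)) P M ∂haarU n =
        evalEntries p A := by
  refine ⟨∑ d ∈ P.support, MvPolynomial.monomial d (∫ M, P.coeff d M ∂haarU n), fun A => ?_⟩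
  simp only [evalEntries, map_sum, MvPolynomial.eval_monomial]
  have : ∀ M : U n, MvPolynomial.eval (fun x => ContinuousMap.const _ (A x.1 x.2)) P M =
      ∑ d ∈ P.support, P.coeff d M * d.prod fun x e => A x.1 x.2 ^ e := by
    intro M
    rw [MvPolynomial.eval_eq, ContinuousMap.coe_sum, Finset.sum_apply]
    refine Finset.sum_congr rfl fun d _ => ?_
    simp [Finsupp.prod, ContinuousMap.prod_apply]
  simp only [this]
  rw [integral_finsetSum _ fun d _ =>
    (integrable_of_continuous (P.coeff d).continuous).mul_const _]
  simp only [integral_mul_const]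

theorem integral_mul_left_U {n : ℕ} (f : U n → ℂ) (V : U n) :
    ∫ M, f (V * M) ∂haarU n = ∫ M, f M ∂haarU n :=
  integral_mul_left_eq_self f V


/-! ### Vanishing of pairings with powers of the determinant -/

section ColumnMoments

variable {n : ℕ}

theorem star_det_mul_det (V : U n) :
    star (V : Matrix (Fin n) (Fin n) ℂ).det * (V : Matrix (Fin n) (Fin n) ℂ).det = 1 := by
  rw [← Matrix.det_conjTranspose, ← Matrix.det_mul, ← Matrix.star_eq_conjTranspose,
    Unitary.coe_star_mul_self, Matrix.det_one]

/-- A diagonal matrix of phases. -/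
def phases (x : Fin n → ℂ) (hx : ∀ i, ‖x i‖ = 1) : U n :=
  ⟨Matrix.diagonal x, by
    rw [Matrix.mem_unitaryGroup_iff, Matrix.star_eq_conjTranspose, Matrix.diagonal_conjTranspose,
      Matrix.diagonal_mul_diagonal, ← Matrix.diagonal_one]
    congr 1
    ext i
    simp [Complex.mul_conj, Complex.normSq_eq_norm_sq, hx]⟩

/-- The pairing of `conj (det M) ^ N` with a product of powers of linear forms in `M`. -/
noncomputable def rowPairing (N : ℕ) (κ : Fin n → ℕ) (b : Fin n → Fin n → ℂ)
    (A : Matrix (Fin n) (Fin n) ℂ) : ℂ :=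
  ∫ M : U n, star (M : Matrix (Fin n) (Fin n) ℂ).det ^ N *
    ∏ i, (∑ s, A i s * ((M : Matrix (Fin n) (Fin n) ℂ).mulVec (b i)) s) ^ κ i ∂haarU n

theorem continuous_det_U : Continuous fun M : U n => (M : Matrix (Fin n) (Fin n) ℂ).det :=
  continuous_subtype_val.matrix_det

theorem continuous_mulVec_U (b : Fin n → ℂ) (s : Fin n) :
    Continuous fun M : U n => ((M : Matrix (Fin n) (Fin n) ℂ).mulVec b) s :=
  (continuous_apply s).comp (continuous_subtype_val.matrix_mulVec continuous_const)

theorem rowPairing_eq_evalEntries (N : ℕ) (κ : Fin n → ℕ) (b : Fin n → Fin n → ℂ) :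
    ∃ p : MvPolynomial (Fin n × Fin n) ℂ, ∀ A, rowPairing N κ b A = evalEntries p A := by
  obtain ⟨p, hp⟩ := exists_evalEntries_eq_integral (n := n)
    (MvPolynomial.C ⟨_, (continuous_star.comp (continuous_det_U (n := n))).pow N⟩ *
      ∏ i, (∑ s, MvPolynomial.X (i, s) * MvPolynomial.C ⟨_, continuous_mulVec_U (b i) s⟩) ^ κ i)
  refine ⟨p, fun A => ?_⟩
  rw [← hp A, rowPairing]
  refine integral_congr_ae (Filter.Eventually.of_forall fun M => ?_)
  simp [map_prod, map_sum, ContinuousMap.prod_apply, ContinuousMap.sum_apply]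

/-- Haar invariance under M ↦ VM, together with conj(det M) = det V · conj(det VM). -/
theorem rowPairing_unitary (N : ℕ) (κ : Fin n → ℕ) (b : Fin n → Fin n → ℂ) (V : U n) :
    rowPairing N κ b V = (V : Matrix (Fin n) (Fin n) ℂ).det ^ N * rowPairing N κ b 1 := by
  rw [rowPairing, rowPairing, ← integral_const_mul]
  refine Eq.trans ?_ (integral_mul_left_U _ V)
  refine integral_congr_ae (Filter.Eventually.of_forall fun M => ?_)
  have hdet : (V : Matrix (Fin n) (Fin n) ℂ).det *
      star ((V * M : U n) : Matrix (Fin n) (Fin n) ℂ).det =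
      star (M : Matrix (Fin n) (Fin n) ℂ).det := by
    rw [Submonoid.coe_mul, Matrix.det_mul, star_mul']
    linear_combination star (M : Matrix (Fin n) (Fin n) ℂ).det * star_det_mul_det V
  beta_reduce
  rw [← hdet, mul_pow]
  refine (mul_assoc _ _ _).trans (congrArg₂ _ rfl (congrArg₂ _ rfl ?_))
  refine Finset.prod_congr rfl fun i _ => congrArg (· ^ κ i) ?_
  rw [Submonoid.coe_mul, ← Matrix.mulVec_mulVec]
  simp [Matrix.one_apply, Matrix.mulVec, dotProduct]

theorem rowPairing_diagonal (N : ℕ) (κ : Fin n → ℕ) (b : Fin n → Fin n → ℂ) (x : Fin n → ℂ) :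
    rowPairing N κ b (Matrix.diagonal x) = (∏ i, x i ^ κ i) * rowPairing N κ b 1 := by
  rw [rowPairing, rowPairing, ← integral_const_mul]
  refine integral_congr_ae (Filter.Eventually.of_forall fun M => ?_)
  simp [Matrix.diagonal_apply, Matrix.one_apply, mul_pow, Finset.prod_mul_distrib]
  ring

/-- A phase ζ in the j-th diagonal place multiplies the pairing by ζ^N through invariance and by
ζ^(κ j) through homogeneity. So the pairing vanishes at 1, hence on U(n), hence everywhere, being
polynomial in A. -/
theorem rowPairing_eq_zero {N : ℕ} {κ : Fin n → ℕ} {j : Fin n} (hj : κ j ≠ N)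
    (b : Fin n → Fin n → ℂ) (A : Matrix (Fin n) (Fin n) ℂ) : rowPairing N κ b A = 0 := by
  have h1 : rowPairing N κ b 1 = 0 := by
    -- The order of ζ exceeds both exponents, so equal powers would force κ j = N.
    have hprim := Complex.isPrimitiveRoot_exp (κ j + N + 1) (by omega)
    set ζ := Complex.exp (2 * Real.pi * Complex.I / (κ j + N + 1 : ℕ))
    have hx : ∀ i, ‖Function.update (fun _ : Fin n => (1 : ℂ)) j ζ i‖ = 1 := by
      intro i
      by_cases h : i = j
      · subst h; simpa using hprim.norm'_eq_one (by omega)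
      · simp [h]
    have h := rowPairing_unitary N κ b (phases _ hx)
    have h' := rowPairing_diagonal N κ b (Function.update (fun _ : Fin n => (1 : ℂ)) j ζ)
    have hp : ∏ i, Function.update (fun _ : Fin n => (1 : ℂ)) j ζ i ^ κ i = ζ ^ κ j := by
      rw [Finset.prod_eq_single j (fun i _ hi => by simp [hi]) (by simp)]
      simp
    have hd : (phases _ hx : Matrix (Fin n) (Fin n) ℂ).det = ζ := by
      simp only [phases, Matrix.det_diagonal]
      rw [Finset.prod_eq_single j (fun i _ hi => by simp [hi]) (by simp)]
      simp
    rw [hd] at h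
    rw [hp] at h'
    have hz : (ζ ^ κ j - ζ ^ N) * rowPairing N κ b 1 = 0 := by
      rw [sub_mul, ← h', ← h]; exact sub_self _
    refine (mul_eq_zero.mp hz).resolve_left fun h0 => hj ?_
    exact hprim.pow_inj (by omega) (by omega) (sub_eq_zero.mp h0)
  obtain ⟨p, hp⟩ := rowPairing_eq_evalEntries N κ b
  rw [hp]
  refine evalEntries_eq_zero (fun V hV => ?_) A
  rw [← hp, rowPairing_unitary N κ b ⟨V, hV⟩, h1, mul_zero]

/-- The quadratic form of `M` at the column `i` of `V`. -/
noncomputable def columnForm (i : Fin n) (M : Matrix (Fin n) (Fin n) ℂ) (V : U n) : ℂ :=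
  ∑ s, star ((V : Matrix (Fin n) (Fin n) ℂ) s i) * M.mulVec (fun r => V r i) s

/-- The moments of the quadratic form of `M` at a random unit vector. -/
noncomputable def sphereMoment (i : Fin n) (k : ℕ) (M : Matrix (Fin n) (Fin n) ℂ) : ℂ :=
  ∫ V, columnForm i M V ^ k ∂haarU n

theorem continuous_columnForm (i : Fin n) :
    Continuous fun x : Matrix (Fin n) (Fin n) ℂ × U n => columnForm i x.1 x.2 := by
  unfold columnForm
  refine continuous_finsetSum _ fun s _ => ?_
  refine (continuous_star.comp ((continuous_entry s i).comp continuous_snd)).mul ?_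
  refine (continuous_apply s).comp (continuous_fst.matrix_mulVec ?_)
  exact continuous_pi fun r => (continuous_entry r i).comp continuous_snd

/-- The product of moments is one integral over independent V i; after exchanging integrals, the
inner one over M is a `rowPairing`. -/
theorem integral_star_det_mul_prod_sphereMoment (i₀ : Fin n) {N : ℕ} {κ : Fin n → ℕ} {j : Fin n}
    (hj : κ j ≠ N) :
    ∫ M : U n, star (M : Matrix (Fin n) (Fin n) ℂ).det ^ N *
      ∏ i, sphereMoment i₀ (κ i) (M : Matrix (Fin n) (Fin n) ℂ) ∂haarU n = 0 := by
  have h1 : ∀ M : U n, star (M : Matrix (Fin n) (Fin n) ℂ).det ^ N *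
      ∏ i, sphereMoment i₀ (κ i) (M : Matrix (Fin n) (Fin n) ℂ) =
      ∫ V : Fin n → U n, star (M : Matrix (Fin n) (Fin n) ℂ).det ^ N *
        ∏ i, columnForm i₀ (M : Matrix (Fin n) (Fin n) ℂ) (V i) ^ κ i
          ∂Measure.pi fun _ => haarU n := by
    intro M
    rw [integral_const_mul, integral_fintype_prod_eq_prod
      (fun i W => columnForm i₀ (M : Matrix (Fin n) (Fin n) ℂ) W ^ κ i)]
    rfl
  simp only [h1]
  rw [integral_integral_swap_of_hasCompactSupport _ (HasCompactSupport.of_compactSpace _)]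
  · have h2 : ∀ V : Fin n → U n, ∫ M : U n, star (M : Matrix (Fin n) (Fin n) ℂ).det ^ N *
        ∏ i, columnForm i₀ (M : Matrix (Fin n) (Fin n) ℂ) (V i) ^ κ i ∂haarU n = 0 := by
      intro V
      exact rowPairing_eq_zero hj (fun i r => (V i : Matrix (Fin n) (Fin n) ℂ) r i₀)
        (Matrix.of fun i s => star ((V i : Matrix (Fin n) (Fin n) ℂ) s i₀))
    simp only [h2, integral_zero]
  · refine Continuous.mul ?_ (continuous_finsetProd _ fun i _ => Continuous.pow ?_ _)
    · exact ((continuous_star.comp continuous_det_U).pow N).comp continuous_fst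
    · exact (continuous_columnForm i₀).comp
        ((continuous_subtype_val.comp continuous_fst).prodMk
          ((continuous_apply i).comp continuous_snd))

end ColumnMoments


/-! ### Complete homogeneous functions of the eigenvalues -/

section CompleteHomogeneous

variable {R S ι : Type*} [CommRing R] [CommRing S] [Fintype ι] [DecidableEq ι]

/-- The complete homogeneous symmetric function of the eigenvalues of a matrix. -/
noncomputable def completeHom (M : Matrix ι ι R) (k : ℕ) : R :=
  PowerSeries.coeff k (PowerSeries.invOfUnit (M.charpolyRev : PowerSeries R) 1)

theorem constantCoeff_charpolyRev (M : Matrix ι ι R) :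
    PowerSeries.constantCoeff (M.charpolyRev : PowerSeries R) = ((1 : Rˣ) : R) := by
  simp [Polynomial.coeff_zero_eq_eval_zero]

theorem completeHom_eq_of_mul_eq_one {M : Matrix ι ι R} {F : PowerSeries R}
    (h : (M.charpolyRev : PowerSeries R) * F = 1) (k : ℕ) :
    completeHom M k = PowerSeries.coeff k F := by
  have h1 := PowerSeries.invOfUnit_mul _ _ (constantCoeff_charpolyRev M)
  rw [completeHom, ← mul_one (PowerSeries.invOfUnit _ _), ← h, ← mul_assoc, h1, one_mul]

theorem charpolyRev_map (φ : R →+* S) (M : Matrix ι ι R) :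
    (M.map φ).charpolyRev = M.charpolyRev.map φ := by
  rw [Matrix.charpolyRev, Matrix.charpolyRev, ← Polynomial.coe_mapRingHom, RingHom.map_det]
  congr 1
  ext i j : 2
  simp [Matrix.one_apply, apply_ite]

theorem completeHom_map (φ : R →+* S) (M : Matrix ι ι R) (k : ℕ) :
    completeHom (M.map φ) k = φ (completeHom M k) := by
  have h1 := PowerSeries.mul_invOfUnit _ _ (constantCoeff_charpolyRev M)
  have h2 := congrArg (PowerSeries.map φ) h1
  rw [map_mul, map_one, ← Polynomial.polynomial_map_coe, ← charpolyRev_map] at h2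
  rw [completeHom_eq_of_mul_eq_one h2, PowerSeries.coeff_map, completeHom]

theorem charpolyRev_eq_of_charpoly_eq {M M' : Matrix ι ι R} (h : M.charpoly = M'.charpoly) :
    M.charpolyRev = M'.charpolyRev := by
  rw [← Matrix.reverse_charpoly, h, Matrix.reverse_charpoly]

/-- The reversed characteristic polynomial is ∏(1 - z_i X), whose inverse is a product of geometric
series. -/
theorem completeHom_diagonal (z : ι → R) (k : ℕ) :
    completeHom (Matrix.diagonal z) k =
      ∑ α ∈ Finset.piAntidiag Finset.univ k, ∏ i, z i ^ α i := by
  have h1 : (Matrix.diagonal z).charpolyRev = ∏ i, (1 - Polynomial.X * Polynomial.C (z i)) := by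
    rw [Matrix.charpolyRev, ← Matrix.det_diagonal]
    congr 1
    ext i j : 2
    by_cases h : i = j
    · subst h; simp
    · simp [h]
  have h2 : ((Matrix.diagonal z).charpolyRev : PowerSeries R) *
      ∏ i, PowerSeries.mk (fun k => z i ^ k) = 1 := by
    rw [h1, ← Polynomial.coeToPowerSeries.ringHom_apply, map_prod, ← Finset.prod_mul_distrib]
    refine Finset.prod_eq_one fun i _ => ?_
    rw [Polynomial.coeToPowerSeries.ringHom_apply]
    ext k
    rw [Polynomial.coe_sub, Polynomial.coe_mul, Polynomial.coe_one, Polynomial.coe_X,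
      Polynomial.coe_C, sub_mul, one_mul, mul_assoc, map_sub]
    cases k with
    | zero => simp
    | succ k => simp [PowerSeries.coeff_succ_X_mul, PowerSeries.coeff_one, pow_succ']
  rw [completeHom_eq_of_mul_eq_one h2, PowerSeries.coeff_prod]
  refine Finset.sum_bij (fun l _ => l) (fun l hl => ?_) (fun _ _ _ _ h => DFunLike.coe_injective h)
    (fun α hα => ⟨Finsupp.equivFunOnFinite.symm α, ?_, ?_⟩) (fun l _ => by simp)
  · simp only [Finset.mem_finsuppAntidiag] at hl
    simpa using hl.1
  · simp only [Finset.mem_piAntidiag] at hα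
    simpa using hα.1
  · rfl

end CompleteHomogeneous

/-! ### Moments of quadratic forms at random unit vectors -/

section SphereMoments

variable {n : ℕ}

/-- Left multiplication by a diagonal phase in a coordinate j with α j ≠ β j preserves the integral
but scales it by ζ^(α j) conj(ζ)^(β j) ≠ 1. -/
theorem integral_monomial_column_eq_zero (i : Fin n) {α β : Fin n → ℕ} (h : α ≠ β) :
    ∫ V : U n, (∏ s, (V : Matrix (Fin n) (Fin n) ℂ) s i ^ α s) *
      ∏ s, star ((V : Matrix (Fin n) (Fin n) ℂ) s i) ^ β s ∂haarU n = 0 := by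
  obtain ⟨j, hj⟩ := Function.ne_iff.mp h
  have hprim := Complex.isPrimitiveRoot_exp (α j + β j + 1) (by omega)
  set ζ := Complex.exp (2 * Real.pi * Complex.I / (α j + β j + 1 : ℕ))
  have hζ : ‖ζ‖ = 1 := hprim.norm'_eq_one (by omega)
  set x : Fin n → ℂ := Function.update (fun _ => 1) j ζ with hxdef
  have hx : ∀ i, ‖x i‖ = 1 := by
    intro i
    by_cases h : i = j
    · subst h; simpa [x] using hζ
    · simp [x, h]
  set W := phases x hx
  have hW : ∀ (V : U n) s, ((W * V : U n) : Matrix (Fin n) (Fin n) ℂ) s i =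
      x s * (V : Matrix (Fin n) (Fin n) ℂ) s i := by
    intro V s
    simp [W, phases, Matrix.diagonal_mul]
  have h1 : ∏ s, x s ^ α s = ζ ^ α j := by
    rw [Finset.prod_eq_single j (fun i _ hi => by simp [x, hi]) (by simp)]
    simp [x]
  have h2 : ∏ s, star (x s) ^ β s = star ζ ^ β j := by
    rw [Finset.prod_eq_single j (fun i _ hi => by simp [x, hi]) (by simp)]
    simp [x]
  have key := integral_mul_left_U (fun V : U n => (∏ s, (V : Matrix (Fin n) (Fin n) ℂ) s i ^ α s) *
      ∏ s, star ((V : Matrix (Fin n) (Fin n) ℂ) s i) ^ β s) W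
  simp only [hW, mul_pow, star_mul', Finset.prod_mul_distrib, h1, h2] at key
  simp only [mul_mul_mul_comm, integral_const_mul] at key
  set J := ∫ V : U n, (∏ s, (V : Matrix (Fin n) (Fin n) ℂ) s i ^ α s) *
      ∏ s, star ((V : Matrix (Fin n) (Fin n) ℂ) s i) ^ β s ∂haarU n
  have hs : star ζ * ζ = 1 := by
    simp [Complex.conj_mul', hζ]
  have hne : ζ ^ α j * star ζ ^ β j ≠ 1 := by
    intro h0
    have : ζ ^ α j = ζ ^ β j := by
      calc ζ ^ α j = ζ ^ α j * (star ζ * ζ) ^ β j := by rw [hs, one_pow, mul_one]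
        _ = (ζ ^ α j * star ζ ^ β j) * ζ ^ β j := by rw [mul_pow]; ring
        _ = ζ ^ β j := by rw [h0, one_mul]
    exact hj (hprim.pow_inj (by omega) (by omega) this)
  have : (ζ ^ α j * star ζ ^ β j - 1) * J = 0 := by rw [sub_mul, one_mul, key, sub_self]
  exact (mul_eq_zero.mp this).resolve_left (sub_ne_zero.mpr hne)

/-- The moments of the squared moduli of the coordinates of a random unit vector. -/
noncomputable def columnMoment (i : Fin n) (α : Fin n → ℕ) : ℂ :=
  ∫ V : U n, (∏ s, (V : Matrix (Fin n) (Fin n) ℂ) s i ^ α s) *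
      ∏ s, star ((V : Matrix (Fin n) (Fin n) ℂ) s i) ^ α s ∂haarU n

theorem continuous_monomial_column (i : Fin n) (α β : Fin n → ℕ) :
    Continuous fun V : U n => (∏ s, (V : Matrix (Fin n) (Fin n) ℂ) s i ^ α s) *
      ∏ s, star ((V : Matrix (Fin n) (Fin n) ℂ) s i) ^ β s :=
  (continuous_finsetProd _ fun s _ => (continuous_entry s i).pow _).mul
    (continuous_finsetProd _ fun s _ => (continuous_star.comp (continuous_entry s i)).pow _)

/-- Any unit vector is a row of a unitary matrix. -/
theorem exists_unitary_row (i : Fin n) (u : Fin n → ℂ) (hu : ∑ s, ‖u s‖ ^ 2 = 1) :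
    ∃ W : U n, ∀ s, (W : Matrix (Fin n) (Fin n) ℂ) i s = u s := by
  have hv : Orthonormal ℂ
      (({i} : Set (Fin n)).domRestrict fun _ => (WithLp.toLp 2 u : EuclideanSpace ℂ (Fin n))) := by
    rw [orthonormal_iff_ite]
    rintro ⟨a, ha⟩ ⟨b, hb⟩
    rw [Set.mem_singleton_iff] at ha hb
    subst ha; subst hb
    have : inner ℂ (WithLp.toLp 2 u : EuclideanSpace ℂ (Fin n)) (WithLp.toLp 2 u) = 1 := by
      have h := EuclideanSpace.norm_sq_eq (𝕜 := ℂ) (WithLp.toLp 2 u)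
      simp only [hu] at h
      rw [inner_self_eq_norm_sq_to_K]
      refine (RCLike.ofReal_pow _ _).symm.trans ?_
      rw [h]
      exact RCLike.ofReal_one
    simpa using this
  obtain ⟨b, hb⟩ := hv.exists_orthonormalBasis_extension_of_card_eq (by simp)
  refine ⟨⟨Matrix.of fun a s => b a s, ?_⟩, fun s => ?_⟩
  · rw [Matrix.mem_unitaryGroup_iff]
    ext a c
    have := orthonormal_iff_ite.mp b.orthonormal c a
    rw [PiLp.inner_apply] at this
    rw [Matrix.mul_apply, Matrix.one_apply]
    simpa [eq_comm, mul_comm] using this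
  · have := hb i rfl
    simp [this]

theorem integral_linear_form_pow (i : Fin n) (k : ℕ) (u : Fin n → ℂ) :
    ∫ V : U n, (∑ s, u s * (V : Matrix (Fin n) (Fin n) ℂ) s i) ^ k *
        star (∑ s, u s * (V : Matrix (Fin n) (Fin n) ℂ) s i) ^ k ∂haarU n =
      ∑ α ∈ Finset.piAntidiag Finset.univ k, (Nat.multinomial Finset.univ α : ℂ) ^ 2 *
        (∏ s, (u s * star (u s)) ^ α s) * columnMoment i α := by
  have h1 : ∀ V : U n, (∑ s, u s * (V : Matrix (Fin n) (Fin n) ℂ) s i) ^ k *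
        star (∑ s, u s * (V : Matrix (Fin n) (Fin n) ℂ) s i) ^ k =
      ∑ α ∈ Finset.piAntidiag Finset.univ k, ∑ β ∈ Finset.piAntidiag Finset.univ k,
        ((Nat.multinomial Finset.univ α : ℂ) * Nat.multinomial Finset.univ β *
          ((∏ s, u s ^ α s) * ∏ s, star (u s) ^ β s)) *
        ((∏ s, (V : Matrix (Fin n) (Fin n) ℂ) s i ^ α s) *
          ∏ s, star ((V : Matrix (Fin n) (Fin n) ℂ) s i) ^ β s) := by
    intro V
    rw [star_sum, Finset.sum_pow_eq_sum_piAntidiag, Finset.sum_pow_eq_sum_piAntidiag,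
      Finset.sum_mul_sum]
    refine Finset.sum_congr rfl fun α _ => Finset.sum_congr rfl fun β _ => ?_
    simp only [star_mul', mul_pow, Finset.prod_mul_distrib]
    ring
  simp only [h1]
  have hint : ∀ α β : Fin n → ℕ, Integrable (fun V : U n =>
      ((Nat.multinomial Finset.univ α : ℂ) * Nat.multinomial Finset.univ β *
          ((∏ s, u s ^ α s) * ∏ s, star (u s) ^ β s)) *
        ((∏ s, (V : Matrix (Fin n) (Fin n) ℂ) s i ^ α s) *
          ∏ s, star ((V : Matrix (Fin n) (Fin n) ℂ) s i) ^ β s)) (haarU n) := fun α β =>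
    (integrable_of_continuous (continuous_monomial_column i α β)).const_mul _
  rw [integral_finsetSum _ fun α _ => integrable_finsetSum _ fun β _ => hint α β]
  refine Finset.sum_congr rfl fun α hα => ?_
  rw [integral_finsetSum _ fun β _ => hint α β, Finset.sum_eq_single α]
  · rw [integral_const_mul, columnMoment]
    simp only [mul_pow, Finset.prod_mul_distrib]
    ring
  · intro β _ hβ
    rw [integral_const_mul, integral_monomial_column_eq_zero i hβ.symm, mul_zero]
  · exact fun h => absurd hα h

/-- The normalized vector √t / r is a row of some unitary W, so the linear form is r times an entry
of WV; by invariance its moment depends on t only through r² = ∑ t. -/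
theorem integral_linear_form_pow_eq (i : Fin n) (k : ℕ) :
    ∃ c : ℂ, ∀ t : Fin n → ℝ, (∀ s, 0 < t s) →
      ∑ α ∈ Finset.piAntidiag Finset.univ k, (Nat.multinomial Finset.univ α : ℂ) ^ 2 *
        (∏ s, (t s : ℂ) ^ α s) * columnMoment i α = c * (∑ s, (t s : ℂ)) ^ k := by
  refine ⟨∫ V : U n, ((V : Matrix (Fin n) (Fin n) ℂ) i i) ^ k *
    star ((V : Matrix (Fin n) (Fin n) ℂ) i i) ^ k ∂haarU n, fun t ht => ?_⟩
  have hr : 0 < ∑ s, t s := Finset.sum_pos (fun s _ => ht s) ⟨i, Finset.mem_univ i⟩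
  set r : ℝ := √(∑ s, t s) with hrdef
  have hr2 : r ^ 2 = ∑ s, t s := Real.sq_sqrt hr.le
  have hr0 : 0 < r := Real.sqrt_pos.mpr hr
  have h := integral_linear_form_pow i k fun s => ((√(t s) : ℝ) : ℂ)
  have hts : ∀ s, ((√(t s) : ℝ) : ℂ) * star ((√(t s) : ℝ) : ℂ) = t s := by
    intro s
    rw [Complex.star_def, Complex.conj_ofReal, ← Complex.ofReal_mul, Real.mul_self_sqrt (ht s).le]
  simp only [hts] at h
  rw [← h]
  obtain ⟨W, hW⟩ := exists_unitary_row i (fun s => ((√(t s) / r : ℝ) : ℂ)) (by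
    simp only [Complex.norm_real, Real.norm_eq_abs, sq_abs, div_pow, Real.sq_sqrt (ht _).le]
    rw [← Finset.sum_div, hr2, div_self hr.ne'])
  have hWV : ∀ V : U n, ∑ s, ((√(t s) : ℝ) : ℂ) * (V : Matrix (Fin n) (Fin n) ℂ) s i =
      r * ((W * V : U n) : Matrix (Fin n) (Fin n) ℂ) i i := by
    intro V
    rw [Submonoid.coe_mul, Matrix.mul_apply, Finset.mul_sum]
    refine Finset.sum_congr rfl fun s _ => ?_
    rw [hW, Complex.ofReal_div]
    have : (r : ℂ) ≠ 0 := by exact_mod_cast hr0.ne'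
    field_simp
  simp only [hWV]
  rw [integral_mul_left_U (fun V : U n => ((r : ℂ) * (V : Matrix (Fin n) (Fin n) ℂ) i i) ^ k *
    star ((r : ℂ) * (V : Matrix (Fin n) (Fin n) ℂ) i i) ^ k) W, mul_comm, ← integral_const_mul]
  refine integral_congr_ae (Filter.Eventually.of_forall fun V => ?_)
  have : (∑ s, (t s : ℂ)) = (r : ℂ) ^ 2 := by
    rw [← Complex.ofReal_pow, hr2, Complex.ofReal_sum]
  simp only [this, star_mul', Complex.star_def, Complex.conj_ofReal]
  ring

/-- Compare coefficients of t^α in the preceding identity, valid on the positive orthant and so as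
polynomials. The constant is nonzero because otherwise the k-th power of the squared norm of a
column, identically 1, would integrate to 0. -/
theorem multinomial_mul_columnMoment (i : Fin n) (k : ℕ) :
    ∃ c : ℂ, c ≠ 0 ∧ ∀ α ∈ Finset.piAntidiag Finset.univ k,
      (Nat.multinomial Finset.univ α : ℂ) * columnMoment i α = c := by
  obtain ⟨c, hc⟩ := integral_linear_form_pow_eq i k
  have hpoly : (∑ α ∈ Finset.piAntidiag (Finset.univ : Finset (Fin n)) k,
      MvPolynomial.monomial (Finsupp.equivFunOnFinite.symm α)
        ((Nat.multinomial Finset.univ α : ℂ) ^ 2 * columnMoment i α)) =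
      ∑ α ∈ Finset.piAntidiag (Finset.univ : Finset (Fin n)) k,
        MvPolynomial.monomial (Finsupp.equivFunOnFinite.symm α)
        (c * (Nat.multinomial Finset.univ α : ℂ)) := by
    refine MvPolynomial.funext_set (fun _ => (fun t : ℝ => (t : ℂ)) '' Set.Ioi 0)
      (fun _ => (Set.Ioi_infinite 0).image (Complex.ofReal_injective.injOn)) fun x hx => ?_
    simp only [Set.mem_pi, Set.mem_univ, forall_const, Set.mem_image, Set.mem_Ioi] at hx
    choose t ht hxt using hx
    have h := hc t ht
    rw [Finset.sum_pow_eq_sum_piAntidiag, Finset.mul_sum] at h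
    simp only [map_sum, MvPolynomial.eval_monomial]
    refine Eq.trans (Finset.sum_congr rfl fun α _ => ?_)
      (h.trans (Finset.sum_congr rfl fun α _ => ?_))
    · simp [Finsupp.prod_fintype, ← hxt]; ring
    · simp [Finsupp.prod_fintype, ← hxt]; ring
  have hcoef : ∀ α ∈ Finset.piAntidiag Finset.univ k,
      (Nat.multinomial Finset.univ α : ℂ) * columnMoment i α = c := by
    intro α hα
    have h := congrArg (MvPolynomial.coeff (Finsupp.equivFunOnFinite.symm α)) hpoly
    simp only [MvPolynomial.coeff_sum, MvPolynomial.coeff_monomial,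
      EmbeddingLike.apply_eq_iff_eq, Finset.sum_ite_eq', hα, if_true] at h
    have hm : (Nat.multinomial Finset.univ α : ℂ) ≠ 0 := by
      exact_mod_cast (Nat.multinomial_pos _ _).ne'
    refine mul_left_cancel₀ hm ?_
    linear_combination h
  refine ⟨c, fun hc0 => ?_, hcoef⟩
  have h1 : ∫ V : U n, (∑ s, (V : Matrix (Fin n) (Fin n) ℂ) s i *
      star ((V : Matrix (Fin n) (Fin n) ℂ) s i)) ^ k ∂haarU n = 1 := by
    have : ∀ V : U n, ∑ s, (V : Matrix (Fin n) (Fin n) ℂ) s i *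
      star ((V : Matrix (Fin n) (Fin n) ℂ) s i) = 1 := by
      intro V
      have h := congrFun (congrFun (Unitary.coe_star_mul_self V) i) i
      rw [Matrix.mul_apply, Matrix.one_apply_eq] at h
      rw [← h]
      exact Finset.sum_congr rfl fun s _ => mul_comm _ _
    simp only [this, one_pow, integral_const, probReal_univ, one_smul]
  have h2 : ∫ V : U n, (∑ s, (V : Matrix (Fin n) (Fin n) ℂ) s i *
      star ((V : Matrix (Fin n) (Fin n) ℂ) s i)) ^ k ∂haarU n = 0 := by
    simp only [Finset.sum_pow_eq_sum_piAntidiag, mul_pow, Finset.prod_mul_distrib]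
    rw [integral_finsetSum _ fun α _ =>
      (integrable_of_continuous (continuous_monomial_column i α α)).const_mul _]
    refine Finset.sum_eq_zero fun α hα => ?_
    rw [integral_const_mul]
    exact (hcoef α hα).trans hc0
  rw [h2] at h1
  exact zero_ne_one h1

theorem sphereMoment_diagonal (i : Fin n) (k : ℕ) {c : ℂ}
    (hc : ∀ α ∈ Finset.piAntidiag Finset.univ k,
      (Nat.multinomial Finset.univ α : ℂ) * columnMoment i α = c) (z : Fin n → ℂ) :
    sphereMoment i k (Matrix.diagonal z) = c * completeHom (Matrix.diagonal z) k := by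
  rw [completeHom_diagonal, Finset.mul_sum]
  have h : ∀ V : U n, columnForm i (Matrix.diagonal z) V ^ k =
      ∑ α ∈ Finset.piAntidiag Finset.univ k, ((Nat.multinomial Finset.univ α : ℂ) *
        ∏ s, z s ^ α s) * ((∏ s, (V : Matrix (Fin n) (Fin n) ℂ) s i ^ α s) *
          ∏ s, star ((V : Matrix (Fin n) (Fin n) ℂ) s i) ^ α s) := by
    intro V
    simp only [columnForm, Matrix.mulVec_diagonal]
    rw [Finset.sum_pow_eq_sum_piAntidiag]
    refine Finset.sum_congr rfl fun α _ => ?_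
    simp only [mul_pow, Finset.prod_mul_distrib]
    ring
  simp only [sphereMoment, h]
  rw [integral_finsetSum _ fun α _ =>
    (integrable_of_continuous (continuous_monomial_column i α α)).const_mul _]
  refine Finset.sum_congr rfl fun α hα => ?_
  rw [integral_const_mul, ← hc α hα, columnMoment]
  ring

theorem columnForm_conj (i : Fin n) (M : Matrix (Fin n) (Fin n) ℂ) (Q V : U n) :
    columnForm i ((Q : Matrix (Fin n) (Fin n) ℂ) * M * (star Q : U n)) V =
      columnForm i M (star Q * V) := by
  have h : ∀ (A : Matrix (Fin n) (Fin n) ℂ) (W : U n), columnForm i A W =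
      (star (W : Matrix (Fin n) (Fin n) ℂ) * (A * W)) i i := by
    intro A W
    rw [Matrix.mul_apply]
    refine Finset.sum_congr rfl fun s _ => ?_
    rw [Matrix.star_apply]
    rfl
  rw [h, h]
  simp only [Submonoid.coe_mul, star_mul, Unitary.coe_star, star_star, Matrix.mul_assoc]

/-- Diagonalize M and absorb the eigenvector matrix into the Haar variable. -/
theorem sphereMoment_hermitian (i : Fin n) (k : ℕ) {c : ℂ}
    (hc : ∀ α ∈ Finset.piAntidiag Finset.univ k,
      (Nat.multinomial Finset.univ α : ℂ) * columnMoment i α = c) {M : Matrix (Fin n) (Fin n) ℂ}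
    (hM : M.IsHermitian) :
    sphereMoment i k M = c * completeHom M k := by
  set Q : U n := hM.eigenvectorUnitary
  set z : Fin n → ℂ := fun j => (hM.eigenvalues j : ℂ)
  have hspec : M = (Q : Matrix (Fin n) (Fin n) ℂ) * Matrix.diagonal z * (star Q : U n) :=
    hM.spectral_theorem
  have hchar : M.charpoly = (Matrix.diagonal z).charpoly := by
    rw [hspec, Matrix.charpoly_mul_comm, ← Matrix.mul_assoc, ← Submonoid.coe_mul,
      Unitary.star_mul_self, Submonoid.coe_one, Matrix.one_mul]
  rw [completeHom, charpolyRev_eq_of_charpoly_eq hchar, ← completeHom,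
    ← sphereMoment_diagonal i k hc, hspec, sphereMoment, sphereMoment]
  simp only [columnForm_conj]
  exact integral_mul_left_U (fun V => columnForm i (Matrix.diagonal z) V ^ k) (star Q)

theorem columnForm_add_smul (i : Fin n) (A B : Matrix (Fin n) (Fin n) ℂ) (z : ℂ) (V : U n) :
    columnForm i (A + z • B) V = columnForm i A V + z * columnForm i B V := by
  simp only [columnForm, Matrix.add_mulVec, Matrix.smul_mulVec, Pi.add_apply, Pi.smul_apply,
    smul_eq_mul, Finset.mul_sum, ← Finset.sum_add_distrib]
  exact Finset.sum_congr rfl fun s _ => by ring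

theorem continuous_columnForm_right (i : Fin n) (M : Matrix (Fin n) (Fin n) ℂ) :
    Continuous (columnForm i M) :=
  (continuous_columnForm i).comp (Continuous.prodMk_right M)

theorem differentiable_sphereMoment_line (i : Fin n) (k : ℕ) (A B : Matrix (Fin n) (Fin n) ℂ) :
    Differentiable ℂ fun z : ℂ => sphereMoment i k (A + z • B) := by
  have h : ∀ z : ℂ, sphereMoment i k (A + z • B) = ∑ m ∈ Finset.range (k + 1),
      z ^ (k - m) *
        ∫ V, columnForm i A V ^ m * columnForm i B V ^ (k - m) * k.choose m ∂haarU n := by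
    intro z
    have hi : ∀ m, Integrable (fun V => columnForm i A V ^ m * columnForm i B V ^ (k - m) *
        (k.choose m : ℂ)) (haarU n) := fun m => (integrable_of_continuous
      (((continuous_columnForm_right i A).pow m).mul
        ((continuous_columnForm_right i B).pow (k - m)))).mul_const _
    simp only [← integral_const_mul]
    rw [← integral_finsetSum _ fun m _ => (hi m).const_mul _, sphereMoment]
    refine integral_congr_ae (Filter.Eventually.of_forall fun V => ?_)
    simp only [columnForm_add_smul, add_pow, mul_pow]
    exact Finset.sum_congr rfl fun m _ => by ring
  rw [funext h]
  fun_prop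

/-- A polynomial in z: it is the value at z of the same function of the matrix A + X B over ℂ[X]. -/
theorem differentiable_completeHom_line (k : ℕ) (A B : Matrix (Fin n) (Fin n) ℂ) :
    Differentiable ℂ fun z : ℂ => completeHom (A + z • B) k := by
  have h : ∀ z : ℂ, completeHom (A + z • B) k = Polynomial.eval z
      (completeHom (A.map Polynomial.C + (Polynomial.X : Polynomial ℂ) • B.map Polynomial.C) k) := by
    intro z
    rw [← Polynomial.coe_evalRingHom, ← completeHom_map]
    congr 1
    ext a b
    simp
    exact mul_comm _ _
  rw [funext h]
  exact Polynomial.differentiable _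

/-- The moments of the quadratic form of a matrix at a random unit vector are proportional to the
complete homogeneous symmetric functions of its eigenvalues. -/
theorem sphereMoment_eq (i : Fin n) (k : ℕ) :
    ∃ c : ℂ, c ≠ 0 ∧ ∀ M : Matrix (Fin n) (Fin n) ℂ,
      sphereMoment i k M = c * completeHom M k := by
  obtain ⟨c, hc0, hc⟩ := multinomial_mul_columnMoment i k
  refine ⟨c, hc0, fun M => ?_⟩
  -- M = A + iB with A, B Hermitian; the identity holds for A + tB with t real and continues to t =
  -- i.
  set A : Matrix (Fin n) (Fin n) ℂ := (1 / 2 : ℂ) • (M + star M) with hA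
  set B : Matrix (Fin n) (Fin n) ℂ := (-Complex.I / 2 : ℂ) • (M - star M) with hB
  have hM : M = A + Complex.I • B := by
    rw [hA, hB, smul_smul]
    have : Complex.I * (-Complex.I / 2) = 1 / 2 := by
      rw [mul_div_assoc', mul_neg, Complex.I_mul_I]; norm_num
    rw [this]
    module
  have hAh : A.IsHermitian := by
    rw [Matrix.IsHermitian, ← Matrix.star_eq_conjTranspose, hA, star_smul]
    simp only [star_add, star_star, RCLike.star_def, map_div₀, map_one, map_ofNat]
    module
  have hBh : B.IsHermitian := by
    rw [Matrix.IsHermitian, ← Matrix.star_eq_conjTranspose, hB, star_smul]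
    simp only [star_sub, star_star, RCLike.star_def, map_div₀, map_neg, Complex.conj_I, map_ofNat]
    module
  have hline := eq_zero_of_real_eq_zero
    (f := fun z : ℂ => sphereMoment i k (A + z • B) - c * completeHom (A + z • B) k)
    ((differentiable_sphereMoment_line i k A B).sub
      ((differentiable_completeHom_line k A B).const_mul c)) (fun t => ?_) Complex.I
  · rw [← hM] at hline
    exact sub_eq_zero.mp hline
  · refine sub_eq_zero.mpr (sphereMoment_hermitian i k hc (hAh.add ?_))
    rw [Matrix.IsHermitian, Matrix.conjTranspose_smul, hBh.eq, Complex.star_def,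
      Complex.conj_ofReal]

theorem integral_star_det_mul_prod_completeHom {N : ℕ} {κ : Fin n → ℕ} {j : Fin n}
    (hj : κ j ≠ N) :
    ∫ M : U n, star (M : Matrix (Fin n) (Fin n) ℂ).det ^ N *
      ∏ i, completeHom (M : Matrix (Fin n) (Fin n) ℂ) (κ i) ∂haarU n = 0 := by
  choose c hc0 hc using fun k => sphereMoment_eq j k
  have h := integral_star_det_mul_prod_sphereMoment j hj
  simp only [hc, Finset.prod_mul_distrib] at h
  simp only [mul_left_comm _ (∏ i, c (κ i)), integral_const_mul] at h
  exact (mul_eq_zero.mp h).resolve_left (Finset.prod_ne_zero_iff.mpr fun i _ => hc0 _)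

end SphereMoments


/-! ### A Jacobi–Trudi formula for products over eigenvalues -/

section DetAeval

open Polynomial

variable {n : ℕ}

/-- The determinant of a polynomial in a matrix is the product of the values of the polynomial at
the eigenvalues. -/
theorem det_aeval_eq_prod_roots (M : Matrix (Fin n) (Fin n) ℂ) (p : ℂ[X]) :
    (aeval M p).det = (M.charpoly.roots.map fun z => p.eval z).prod := by
  have hcard : Multiset.card M.charpoly.roots = n := by
    rw [← (IsAlgClosed.splits M.charpoly).natDegree_eq_card_roots]
    simp
  have hC : ∀ a : ℂ, (aeval M (C a)).det = (M.charpoly.roots.map fun z => (C a).eval z).prod := by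
    intro a
    simp [hcard, Matrix.algebraMap_eq_diagonal]
  have hX : ∀ r : ℂ, (aeval M (X - C r)).det =
      (M.charpoly.roots.map fun z => (X - C r).eval z).prod := by
    intro r
    have h1 : (Matrix.scalar (Fin n) r - M).det = (M.charpoly.roots.map fun z => r - z).prod := by
      rw [← Matrix.eval_charpoly]
      conv_lhs => rw [(IsAlgClosed.splits M.charpoly).eq_prod_roots, M.charpoly_monic.leadingCoeff]
      rw [map_one, one_mul, eval_multiset_prod, Multiset.map_map]
      simp
    have h2 : aeval M (X - C r) = -(Matrix.scalar (Fin n) r - M) := by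
      rw [map_sub, aeval_X, aeval_C, neg_sub]
      rfl
    have h3 : (M.charpoly.roots.map fun z => (X - C r).eval z) =
        (M.charpoly.roots.map fun z => -1 * (r - z)) := by
      refine Multiset.map_congr rfl fun z _ => ?_
      simp
    rw [h2, Matrix.det_neg, h1, h3, Multiset.prod_map_mul, Multiset.map_const', hcard,
      Multiset.prod_replicate, Fintype.card_fin]
  -- Both sides are multiplicative in p and p splits over ℂ, so constants and linear factors
  -- suffice.
  let f : ℂ[X] →* ℂ := (Matrix.detMonoidHom (n := Fin n) (R := ℂ)).comp
    ((aeval M : ℂ[X] →ₐ[ℂ] Matrix (Fin n) (Fin n) ℂ) : ℂ[X] →* Matrix (Fin n) (Fin n) ℂ)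
  let g : ℂ[X] →* ℂ :=
    { toFun := fun p => (M.charpoly.roots.map fun z => p.eval z).prod
      map_one' := by simp
      map_mul' := fun p q => by simp [Multiset.prod_map_mul] }
  change f p = g p
  rw [(IsAlgClosed.splits p).eq_prod_roots, map_mul, map_mul, map_multiset_prod, map_multiset_prod,
    Multiset.map_map, Multiset.map_map]
  refine congrArg₂ _ (hC _) (congrArg _ (Multiset.map_congr rfl fun r _ => hX r))

/-- The complete homogeneous functions, extended by zero to negative degrees. -/
noncomputable def homZ (M : Matrix (Fin n) (Fin n) ℂ) (m : ℤ) : ℂ :=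
  if 0 ≤ m then completeHom M m.toNat else 0

theorem homZ_natCast (M : Matrix (Fin n) (Fin n) ℂ) (m : ℕ) : homZ M m = completeHom M m := by
  simp [homZ]

theorem homZ_of_neg (M : Matrix (Fin n) (Fin n) ℂ) {m : ℤ} (h : m < 0) : homZ M m = 0 := by
  simp [homZ, h]

theorem sum_charpolyRev_mul_homZ (M : Matrix (Fin n) (Fin n) ℂ) (L : ℕ) (hL : L ≠ 0) :
    ∑ j ∈ Finset.range (n + 1), M.charpolyRev.coeff j * homZ M (L - j) = 0 := by
  have h := congrArg (PowerSeries.coeff L)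
    (PowerSeries.mul_invOfUnit _ _ (constantCoeff_charpolyRev M))
  rw [PowerSeries.coeff_mul, PowerSeries.coeff_one, if_neg hL,
    Finset.Nat.sum_antidiagonal_eq_sum_range_succ_mk] at h
  have h1 : ∑ j ∈ Finset.range (L + 1), M.charpolyRev.coeff j * homZ M (L - j) = 0 := by
    rw [← h]
    refine Finset.sum_congr rfl fun j hj => ?_
    have : (L : ℤ) - j = ((L - j : ℕ) : ℤ) := by
      have := Finset.mem_range.mp hj
      omega
    rw [this, homZ_natCast, completeHom, Polynomial.coeff_coe]
  have hdeg : M.charpolyRev.natDegree ≤ n := by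
    rw [← Matrix.reverse_charpoly]
    exact (reverse_natDegree_le _).trans (by simp)
  rw [← h1]
  trans ∑ j ∈ Finset.range (n + L + 1), M.charpolyRev.coeff j * homZ M (L - j)
  · refine Finset.sum_subset (Finset.range_mono (by omega)) fun j _ hj => ?_
    rw [coeff_eq_zero_of_natDegree_lt, zero_mul]
    have := Finset.mem_range.not.mp hj
    omega
  · refine (Finset.sum_subset (Finset.range_mono (by omega)) fun j _ hj => ?_).symm
    rw [homZ_of_neg, mul_zero]
    have := Finset.mem_range.not.mp hj
    omega

/-- The recurrence for the h_k read backwards, at L = m + n. The bound on m excludes L = 0, where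
the coefficient is 1 instead of 0. -/
theorem sum_charpoly_mul_homZ (M : Matrix (Fin n) (Fin n) ℂ) (m : ℤ) (hm : -(n : ℤ) < m) :
    ∑ l ∈ Finset.range (n + 1), M.charpoly.coeff l * homZ M (m + l) = 0 := by
  obtain ⟨L, hL⟩ : ∃ L : ℕ, (L : ℤ) = m + n := ⟨(m + n).toNat, by omega⟩
  rw [← sum_charpolyRev_mul_homZ M L (by omega), ← Finset.sum_range_reflect]
  refine Finset.sum_congr rfl fun j hj => ?_
  have hj' := Finset.mem_range.mp hj
  congr 1
  · rw [← Matrix.reverse_charpoly, coeff_reverse]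
    simp only [Matrix.charpoly_natDegree_eq_dim, Fintype.card_fin]
    rw [revAt_le (by omega)]
    congr 1
  · congr 1
    omega

/-- The linear functional sending `X ^ k` to the complete homogeneous function of degree
`k + m`. -/
noncomputable def homFunctional (M : Matrix (Fin n) (Fin n) ℂ) (m : ℤ) : ℂ[X] →ₗ[ℂ] ℂ :=
  lsum fun k => (homZ M (k + m)) • LinearMap.id

theorem homFunctional_apply (M : Matrix (Fin n) (Fin n) ℂ) (m : ℤ) (p : ℂ[X]) :
    homFunctional M m p = ∑ k ∈ p.support, p.coeff k * homZ M (k + m) := by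
  simp [homFunctional, sum_def, mul_comm]

theorem homFunctional_monomial (M : Matrix (Fin n) (Fin n) ℂ) (m : ℤ) (k : ℕ) (a : ℂ) :
    homFunctional M m (monomial k a) = a * homZ M (k + m) := by
  rw [homFunctional, lsum_apply, sum_monomial_index] <;> simp [mul_comm]

theorem homFunctional_mul_X (M : Matrix (Fin n) (Fin n) ℂ) (m : ℤ) (p : ℂ[X]) :
    homFunctional M m (p * X) = homFunctional M (m + 1) p := by
  induction p using Polynomial.induction_on' with
  | add p q hp hq => rw [add_mul, map_add, map_add, hp, hq]
  | monomial k a =>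
    rw [monomial_mul_X, homFunctional_monomial, homFunctional_monomial]
    congr 2
    push_cast
    ring

theorem sum_charpoly_mul_homFunctional (M : Matrix (Fin n) (Fin n) ℂ) (m : ℤ) (hm : -(n : ℤ) < m)
    (p : ℂ[X]) :
    ∑ l ∈ Finset.range (n + 1), M.charpoly.coeff l * homFunctional M (m + l) p = 0 := by
  simp only [homFunctional_apply, Finset.mul_sum]
  rw [Finset.sum_comm]
  refine Finset.sum_eq_zero fun k _ => ?_
  have h := sum_charpoly_mul_homZ M (k + m) (by omega)
  rw [← mul_zero (p.coeff k), ← h, Finset.mul_sum]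
  refine Finset.sum_congr rfl fun l _ => ?_
  rw [← add_assoc (k : ℤ) m l]
  ring

/-- The matrix of complete homogeneous functions attached to a polynomial. -/
noncomputable def homMatrix (M : Matrix (Fin n) (Fin n) ℂ) (p : ℂ[X]) : Matrix (Fin n) (Fin n) ℂ :=
  Matrix.of fun i j => homFunctional M ((j : ℤ) - i) p

/-- The companion matrix of the characteristic polynomial. -/
noncomputable def companionOf (M : Matrix (Fin n) (Fin n) ℂ) : Matrix (Fin n) (Fin n) ℂ :=
  Matrix.of fun i j =>
    if (j : ℕ) + 1 < n then (if (i : ℕ) = j + 1 then 1 else 0) else -M.charpoly.coeff i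

/-- Multiplying p by X shifts the columns by one; the new last column is given by the recurrence as
a combination of the old ones. The companion matrix encodes both. -/
theorem homMatrix_mul_X (M : Matrix (Fin n) (Fin n) ℂ) (p : ℂ[X]) :
    homMatrix M (p * X) = homMatrix M p * companionOf M := by
  ext i j
  simp only [homMatrix, companionOf, Matrix.mul_apply, Matrix.of_apply, homFunctional_mul_X]
  by_cases hj : (j : ℕ) + 1 < n
  · rw [Finset.sum_eq_single (⟨j + 1, hj⟩ : Fin n)]
    · have e : (j : ℤ) - i + 1 = ((j + 1 : ℕ) : ℤ) - i := by push_cast; ring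
      simp only [hj, if_true, mul_one, e]
    · intro b _ hb
      have : (b : ℕ) ≠ j + 1 := fun h => hb (Fin.ext h)
      simp [hj, this]
    · simp
  · have hj' : (j : ℕ) + 1 = n := by omega
    simp only [hj, if_false]
    have h := sum_charpoly_mul_homFunctional M (-(i : ℤ)) (by omega) p
    rw [Finset.sum_range_succ] at h
    have hmonic : M.charpoly.coeff n = 1 := by
      have := M.charpoly_monic
      rwa [Monic, leadingCoeff, Matrix.charpoly_natDegree_eq_dim, Fintype.card_fin] at this
    rw [hmonic, one_mul] at h
    have e1 : (j : ℤ) - i + 1 = -i + n := by omega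
    rw [e1, eq_neg_of_add_eq_zero_right h, Finset.sum_range, ← Finset.sum_neg_distrib]
    refine Finset.sum_congr rfl fun l _ => ?_
    rw [neg_add_eq_sub, mul_neg, mul_comm]

theorem homMatrix_eq (M : Matrix (Fin n) (Fin n) ℂ) (p : ℂ[X]) :
    homMatrix M p = homMatrix M 1 * aeval (companionOf M) p := by
  have hadd : ∀ p q, homMatrix M (p + q) = homMatrix M p + homMatrix M q := by
    intro p q
    ext i j
    simp [homMatrix]
  induction p using Polynomial.induction_on with
  | C a =>
    have : homMatrix M (C a) = a • homMatrix M 1 := by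
      ext i j
      rw [← mul_one (C a), ← smul_eq_C_mul]
      simp [homMatrix]
    rw [this, aeval_C, Algebra.algebraMap_eq_smul_one, mul_smul_comm, mul_one]
  | add p q hp hq => rw [hadd, hp, hq, map_add, mul_add]
  | monomial k a h =>
    rw [pow_succ, ← mul_assoc, homMatrix_mul_X, h, map_mul (aeval (companionOf M)) _ X, aeval_X,
      Matrix.mul_assoc]

/-- Unitriangular, as h_0 = 1 and negative degrees give 0. -/
theorem det_homMatrix_one (M : Matrix (Fin n) (Fin n) ℂ) : (homMatrix M 1).det = 1 := by
  have h1 : ∀ i j, homMatrix M 1 i j = homZ M ((j : ℤ) - i) := by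
    intro i j
    rw [homMatrix, Matrix.of_apply, ← monomial_zero_one, homFunctional_monomial]
    simp
  have h0 : completeHom M 0 = 1 := by
    rw [completeHom, PowerSeries.coeff_zero_eq_constantCoeff, PowerSeries.constantCoeff_invOfUnit]
    simp
  rw [Matrix.det_of_isUpperTriangular]
  · refine Finset.prod_eq_one fun i _ => ?_
    rw [h1, sub_self, ← h0]
    exact homZ_natCast M 0
  · intro i j hij
    rw [h1]
    apply homZ_of_neg
    have : (j : ℕ) < i := hij
    omega

/-- The recurrence and the invertibility of `homMatrix M 1` show that `M.charpoly` kills the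
companion matrix K. The difference q of the two monic polynomials then kills K and has degree below
n. -/
theorem charpoly_companionOf (M : Matrix (Fin n) (Fin n) ℂ) :
    (companionOf M).charpoly = M.charpoly := by
  rcases Nat.eq_zero_or_pos n with rfl | hn
  · rw [Subsingleton.elim (companionOf M) M]
  have hzero : aeval (companionOf M) M.charpoly = 0 := by
    have h1 : homMatrix M M.charpoly = 0 := by
      ext i j
      have h := sum_charpoly_mul_homZ M ((j : ℤ) - i) (by omega)
      rw [homMatrix, Matrix.of_apply, homFunctional_apply, Matrix.zero_apply, ← h]
      refine Finset.sum_subset_zero_on_sdiff (fun k hk => ?_) (fun k hk => ?_) (fun k _ => ?_)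
      · have := le_natDegree_of_mem_supp k hk
        rw [Matrix.charpoly_natDegree_eq_dim, Fintype.card_fin] at this
        exact Finset.mem_range.mpr (by omega)
      · rw [notMem_support_iff.mp (Finset.mem_sdiff.mp hk).2, zero_mul]
      · rw [add_comm]
    rw [homMatrix_eq] at h1
    have hu : IsUnit (homMatrix M 1) := by
      rw [Matrix.isUnit_iff_isUnit_det, det_homMatrix_one]
      exact isUnit_one
    exact (hu.mul_right_eq_zero).mp h1
  set K := companionOf M
  set q := M.charpoly - K.charpoly with hq
  have hqK : aeval K q = 0 := by
    rw [hq, map_sub, hzero, Matrix.aeval_self_charpoly, sub_zero]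
  -- The first basis vector is cyclic for K, so no nonzero polynomial of degree below n kills K.
  have hpow : ∀ k (hk : k < n), (K ^ k).col ⟨0, hn⟩ = Pi.single ⟨k, hk⟩ 1 := by
    intro k
    induction k with
    | zero =>
      intro hk
      ext i
      simp [Matrix.one_apply, Pi.single_apply]
    | succ k ih =>
      intro hk
      have hk' : k < n := by omega
      have : (K ^ (k + 1)).col ⟨0, hn⟩ = K.mulVec ((K ^ k).col ⟨0, hn⟩) := by
        ext i
        rw [pow_succ', Matrix.col_apply, Matrix.mul_apply]
        rfl
      rw [this, ih hk']
      ext i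
      rw [Matrix.mulVec_single_one]
      simp only [K, companionOf, Matrix.col_apply, Matrix.of_apply, hk, if_true, Pi.single_apply,
        Fin.ext_iff]
  have hdeg : q.degree < n := by
    have := degree_sub_lt_left (p := M.charpoly) (q := K.charpoly)
      (by simp [Matrix.charpoly_degree_eq_dim]) M.charpoly_monic.ne_zero
      (by rw [M.charpoly_monic.leadingCoeff, K.charpoly_monic.leadingCoeff])
    simpa [Matrix.charpoly_degree_eq_dim] using this
  have hq0 : q = 0 := by
    ext k
    by_cases hk : k < n
    · have h1 : aeval K q = ∑ j ∈ Finset.range n, q.coeff j • K ^ j :=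
        aeval_eq_sum_range' (by
          by_cases h : q = 0
          · simpa [h] using hn
          · exact (natDegree_lt_iff_degree_lt h).mpr hdeg) K
      have h2 := congrFun (congrFun (hqK.symm.trans h1) ⟨k, hk⟩) ⟨0, hn⟩
      rw [Matrix.zero_apply, Matrix.sum_apply, Finset.sum_eq_single k] at h2
      · have := congrFun (hpow k hk) ⟨k, hk⟩
        simp only [Matrix.col_apply, Pi.single_eq_same] at this
        simpa [this] using h2.symm
      · intro j hj hjk
        have := congrFun (hpow j (Finset.mem_range.mp hj)) ⟨k, hk⟩
        simp only [Matrix.col_apply, Pi.single_apply, Fin.ext_iff, hjk.symm, if_false] at this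
        simp [this]
      · intro h
        exact absurd (Finset.mem_range.mpr hk) h
    · rw [coeff_eq_zero_of_degree_lt (hdeg.trans_le (by exact_mod_cast not_lt.mp hk)), coeff_zero]
  exact (sub_eq_zero.mp hq0).symm

/-- The determinant of a polynomial in a matrix, through complete homogeneous functions. -/
theorem det_homMatrix (M : Matrix (Fin n) (Fin n) ℂ) (p : ℂ[X]) :
    (homMatrix M p).det = (M.charpoly.roots.map fun z => p.eval z).prod := by
  rw [homMatrix_eq, Matrix.det_mul, det_homMatrix_one, one_mul, det_aeval_eq_prod_roots,
    charpoly_companionOf]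

end DetAeval


/-! ### The Heine–Szegő identity -/

section HeineSzego

open Polynomial

variable {n : ℕ}

theorem continuous_completeHom (k : ℕ) :
    Continuous fun M : U n => completeHom (M : Matrix (Fin n) (Fin n) ℂ) k := by
  have h : ∀ M : U n, completeHom (M : Matrix (Fin n) (Fin n) ℂ) k =
      MvPolynomial.eval (fun x : Fin n × Fin n => (M : Matrix (Fin n) (Fin n) ℂ) x.1 x.2)
        (completeHom (Matrix.mvPolynomialX (Fin n) (Fin n) ℂ) k) := by
    intro M
    rw [← completeHom_map]
    congr 1
    ext i j
    simp
  rw [funext h]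
  exact (MvPolynomial.continuous_eval _).comp
    (continuous_pi fun x : Fin n × Fin n => continuous_entry x.1 x.2)

theorem continuous_homZ (m : ℤ) :
    Continuous fun M : U n => homZ (M : Matrix (Fin n) (Fin n) ℂ) m := by
  unfold homZ
  split_ifs
  · exact continuous_completeHom _
  · exact continuous_const

theorem integral_star_det_mul_prod_homZ (N : ℕ) (m : Fin n → ℤ) :
    ∫ M : U n, star (M : Matrix (Fin n) (Fin n) ℂ).det ^ N *
      ∏ i, homZ (M : Matrix (Fin n) (Fin n) ℂ) (m i) ∂haarU n =
    (∫ M : U n, star (M : Matrix (Fin n) (Fin n) ℂ).det ^ N *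
      ∏ _i : Fin n, completeHom (M : Matrix (Fin n) (Fin n) ℂ) N ∂haarU n) *
      ∏ i, if m i = N then 1 else 0 := by
  by_cases hm : ∀ i, m i = N
  · simp [hm, homZ_natCast]
  push Not at hm
  obtain ⟨j, hj⟩ := hm
  rw [Finset.prod_eq_zero (Finset.mem_univ j) (if_neg hj), mul_zero]
  by_cases hneg : ∃ i, m i < 0
  · obtain ⟨i, hi⟩ := hneg
    have : ∀ M : U n, ∏ i, homZ (M : Matrix (Fin n) (Fin n) ℂ) (m i) = 0 := fun M =>
      Finset.prod_eq_zero (Finset.mem_univ i) (homZ_of_neg _ hi)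
    simp [this]
  · push Not at hneg
    have h := integral_star_det_mul_prod_completeHom (n := n) (N := N)
      (κ := fun i => (m i).toNat) (j := j) (by have := hneg j; omega)
    rw [← h]
    refine integral_congr_ae (Filter.Eventually.of_forall fun M => ?_)
    simp [homZ, hneg]

/-- The coefficients of a polynomial, extended by zero to negative degrees. -/
noncomputable def coeffZ (p : ℂ[X]) (m : ℤ) : ℂ := if 0 ≤ m then p.coeff m.toNat else 0

theorem sum_support_ite_eq_coeffZ (p : ℂ[X]) (a N : ℤ) :
    ∑ k ∈ p.support, p.coeff k * (if (k : ℤ) + a = N then 1 else 0) = coeffZ p (N - a) := by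
  unfold coeffZ
  split_ifs with h
  · rw [Finset.sum_eq_single (N - a).toNat]
    · rw [if_pos (by omega), mul_one]
    · intro k _ hk
      rw [if_neg (by omega), mul_zero]
    · intro h0
      rw [notMem_support_iff.mp h0, zero_mul]
  · refine Finset.sum_eq_zero fun k _ => ?_
    rw [if_neg (by omega), mul_zero]

/-- Expand the determinant over permutations and its entries over the coefficients of p. Only terms
whose degrees all equal N survive, all with the same integral, and their coefficients reassemble
into a Toeplitz determinant. -/
theorem integral_star_det_mul_prod_eval_aux (N : ℕ) (p : ℂ[X]) :
    ∫ M : U n, star (M : Matrix (Fin n) (Fin n) ℂ).det ^ N *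
      ((M : Matrix (Fin n) (Fin n) ℂ).charpoly.roots.map fun z => p.eval z).prod ∂haarU n =
    (∫ M : U n, star (M : Matrix (Fin n) (Fin n) ℂ).det ^ N *
      ∏ _i : Fin n, completeHom (M : Matrix (Fin n) (Fin n) ℂ) N ∂haarU n) *
      (Matrix.of fun i j : Fin n => coeffZ p (N + i - j)).det := by
  set C₀ := ∫ M : U n, star (M : Matrix (Fin n) (Fin n) ℂ).det ^ N *
      ∏ _i : Fin n, completeHom (M : Matrix (Fin n) (Fin n) ℂ) N ∂haarU n with hC₀
  have h1 : ∀ M : U n, star (M : Matrix (Fin n) (Fin n) ℂ).det ^ N *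
      ((M : Matrix (Fin n) (Fin n) ℂ).charpoly.roots.map fun z => p.eval z).prod =
      ∑ σ : Equiv.Perm (Fin n), ∑ κ ∈ Fintype.piFinset fun _ : Fin n => p.support,
        ((Equiv.Perm.sign σ : ℤ) * ∏ i, p.coeff (κ i) : ℂ) *
        (star (M : Matrix (Fin n) (Fin n) ℂ).det ^ N *
          ∏ i, homZ (M : Matrix (Fin n) (Fin n) ℂ) (κ i + ((i : ℤ) - σ i))) := by
    intro M
    rw [← det_homMatrix, Matrix.det_apply' (homMatrix _ p), Finset.mul_sum]
    refine Finset.sum_congr rfl fun σ _ => ?_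
    simp only [homMatrix, Matrix.of_apply, homFunctional_apply]
    rw [Finset.prod_univ_sum, Finset.mul_sum, Finset.mul_sum]
    refine Finset.sum_congr rfl fun κ _ => ?_
    rw [Finset.prod_mul_distrib]
    ring
  have hint : ∀ (a : ℂ) (m : Fin n → ℤ), Integrable (fun M : U n => a *
      (star (M : Matrix (Fin n) (Fin n) ℂ).det ^ N *
          ∏ i, homZ (M : Matrix (Fin n) (Fin n) ℂ) (m i))) (haarU n) := fun a m =>
    (integrable_of_continuous (((continuous_star.comp continuous_det_U).pow N).mul
      (continuous_finsetProd _ fun i _ => continuous_homZ (m i)))).const_mul a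
  simp only [h1]
  rw [integral_finsetSum _ fun σ _ => integrable_finsetSum _ fun κ _ => hint _ _,
    Matrix.det_apply', Finset.mul_sum]
  refine Finset.sum_congr rfl fun σ _ => ?_
  rw [integral_finsetSum _ fun κ _ => hint _ _]
  simp only [integral_const_mul, integral_star_det_mul_prod_homZ, ← hC₀]
  have h2 : ∏ i, (Matrix.of fun i j : Fin n => coeffZ p (N + i - j)) (σ i) i =
      ∏ i : Fin n, ∑ k ∈ p.support,
        p.coeff k * (if (k : ℤ) + ((i : ℤ) - σ i) = N then 1 else 0) := by
    refine Finset.prod_congr rfl fun i _ => ?_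
    rw [sum_support_ite_eq_coeffZ, Matrix.of_apply]
    congr 1
    ring
  rw [h2, Finset.prod_univ_sum, Finset.mul_sum, Finset.mul_sum]
  refine Finset.sum_congr rfl fun κ _ => ?_
  rw [Finset.prod_mul_distrib]
  ring

/-- The average of `∏ z⁻ᴺ p z` over the eigenvalues of a random unitary matrix is a Toeplitz
determinant. -/
theorem integral_star_det_mul_prod_eval (N : ℕ) (p : ℂ[X]) :
    ∫ M : U n, star (M : Matrix (Fin n) (Fin n) ℂ).det ^ N *
      ((M : Matrix (Fin n) (Fin n) ℂ).charpoly.roots.map fun z => p.eval z).prod ∂haarU n =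
      (Matrix.of fun i j : Fin n => coeffZ p (N + i - j)).det := by
  rw [integral_star_det_mul_prod_eval_aux]
  -- For p = X^N both the integrand and the determinant are 1, which fixes the constant.
  have h := integral_star_det_mul_prod_eval_aux (n := n) N (X ^ N)
  have h1 : ∀ M : U n, star (M : Matrix (Fin n) (Fin n) ℂ).det ^ N *
      ((M : Matrix (Fin n) (Fin n) ℂ).charpoly.roots.map fun z => (X ^ N : ℂ[X]).eval z).prod =
      1 := by
    intro M
    rw [← det_aeval_eq_prod_roots, map_pow, aeval_X, Matrix.det_pow, ← mul_pow, star_det_mul_det,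
      one_pow]
  have h2 : (Matrix.of fun i j : Fin n => coeffZ (X ^ N : ℂ[X]) (N + i - j)) = 1 := by
    ext i j
    rw [Matrix.of_apply, Matrix.one_apply, coeffZ]
    by_cases hij : i = j
    · subst hij
      simp
    · have hij' : (i : ℕ) ≠ j := fun h => hij (Fin.ext h)
      rw [if_neg hij]
      split_ifs with h0
      · rw [coeff_X_pow, if_neg (by omega)]
      · rfl
  simp only [h1, h2, integral_const, probReal_univ, one_smul, Matrix.det_one, mul_one] at h
  rw [← h, one_mul]

/-- The circle `ℝ / 2πℤ`. -/
abbrev Circ : Type := AddCircle (2 * Real.pi)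

/-- The Fourier coefficient as a continuous linear functional. -/
noncomputable def fourierCoeffCLM (m : ℤ) : C(Circ, ℂ) →L[ℂ] ℂ :=
  LinearMap.mkContinuous
    { toFun := fun g => fourierCoeff g m
      map_add' := fun g h => by
        rw [ContinuousMap.coe_add, fourierCoeff.add
          (g.continuous.integrable_of_hasCompactSupport (HasCompactSupport.of_compactSpace _))
          (h.continuous.integrable_of_hasCompactSupport (HasCompactSupport.of_compactSpace _))]
        rfl
      map_smul' := fun c g => fourierCoeff.const_smul g c m } 1 fun g => by
    rw [one_mul]
    refine (norm_integral_le_of_norm_le_const (C := ‖g‖)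
      (Filter.Eventually.of_forall fun t => ?_)).trans (by simp)
    rw [norm_smul, fourier_apply, Circle.norm_coe, one_mul]
    exact g.norm_coe_le_norm t

theorem fourierCoeffCLM_apply (m : ℤ) (g : C(Circ, ℂ)) :
    fourierCoeffCLM m g = fourierCoeff g m := rfl

theorem fourierCoeffCLM_fourier (m k : ℤ) :
    fourierCoeffCLM m (fourier k) = if m = k then 1 else 0 := by
  rw [fourierCoeffCLM_apply, fourierCoeff_fourier, Pi.single_apply]

/-- The product of the values of `g` at the eigenangles. -/
noncomputable def prodStat (g : Circ → ℂ) (M : U n) : ℂ :=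
  ((M : Matrix (Fin n) (Fin n) ℂ).charpoly.roots.map
    fun z : ℂ => g ((z.arg : ℝ) : Circ)).prod

theorem norm_root (M : U n) {z : ℂ} (hz : z ∈ (M : Matrix (Fin n) (Fin n) ℂ).charpoly.roots) :
    ‖z‖ = 1 := by
  open scoped Matrix.Norms.L2Operator in
  have h := Matrix.mem_spectrum_of_isRoot_charpoly (isRoot_of_mem_roots hz)
  simpa using Unitary.spectrum_subset_circle (𝕜 := ℂ) M h

theorem fourier_arg {z : ℂ} (hz : ‖z‖ = 1) (k : ℤ) :
    fourier k ((z.arg : ℝ) : Circ) = z ^ k := by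
  rw [fourier_coe_apply]
  have h : z = Complex.exp (z.arg * Complex.I) := by
    conv_lhs => rw [← Complex.norm_mul_exp_arg_mul_I z, hz]
    simp
  conv_rhs => rw [h]
  rw [← Complex.exp_int_mul]
  congr 1
  have : (Real.pi : ℂ) ≠ 0 := by exact_mod_cast Real.pi_ne_zero
  push_cast
  field_simp

/-- The Toeplitz matrix of a symbol. -/
noncomputable def toeplitz (n : ℕ) (g : C(Circ, ℂ)) : Matrix (Fin n) (Fin n) ℂ :=
  Matrix.of fun i j => fourierCoeffCLM ((i : ℤ) - j) g

/-- The trigonometric polynomial with given coefficients. -/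
noncomputable def trigPoly (a : ℤ →₀ ℂ) : C(Circ, ℂ) := a.sum fun k c => c • fourier k

/-- On the circle the symbol is z^(-N) times a polynomial, and the product of the z^(-N) over the
eigenvalues is conj(det M)^N. -/
theorem prodStat_trig (a : ℤ →₀ ℂ) (N : ℕ) (hN : ∀ k ∈ a.support, -(N : ℤ) ≤ k) (M : U n) :
    prodStat (trigPoly a) M =
      star (M : Matrix (Fin n) (Fin n) ℂ).det ^ N *
      ((M : Matrix (Fin n) (Fin n) ℂ).charpoly.roots.map fun z =>
        (∑ k ∈ a.support, monomial (k + N).toNat (a k)).eval z).prod := by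
  have h1 : ∀ z ∈ (M : Matrix (Fin n) (Fin n) ℂ).charpoly.roots,
      (∑ k ∈ a.support, monomial (k + N).toNat (a k)).eval z =
        (X ^ N : ℂ[X]).eval z * (trigPoly a)
          ((z.arg : ℝ) : Circ) := by
    intro z hz
    have hz1 := norm_root M hz
    have hz0 : z ≠ 0 := by
      rintro rfl
      simp at hz1
    rw [trigPoly, Finsupp.sum, ContinuousMap.coe_sum, Finset.sum_apply, eval_finsetSum, Finset.mul_sum]
    refine Finset.sum_congr rfl fun k hk => ?_
    rw [eval_monomial, ContinuousMap.smul_apply, fourier_arg hz1, eval_pow, eval_X, smul_eq_mul,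
      ← zpow_natCast, ← zpow_natCast z N, Int.toNat_of_nonneg (by have := hN k hk; omega),
      zpow_add₀ hz0]
    ring
  rw [Multiset.map_congr rfl h1, Multiset.prod_map_mul, ← det_aeval_eq_prod_roots, map_pow, aeval_X,
    Matrix.det_pow, ← mul_assoc, ← mul_pow, star_det_mul_det, one_pow, one_mul]
  rfl

theorem integral_prodStat_trig (a : ℤ →₀ ℂ) :
    Continuous (fun M : U n => prodStat (trigPoly a) M) ∧
    ∫ M : U n, prodStat (trigPoly a) M ∂haarU n =
      (toeplitz n (trigPoly a)).det := by
  obtain ⟨N, hN⟩ : ∃ N : ℕ, ∀ k ∈ a.support, -(N : ℤ) ≤ k := by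
    refine ⟨∑ k ∈ a.support, k.natAbs, fun k hk => ?_⟩
    have := Finset.single_le_sum (f := Int.natAbs) (fun _ _ => Nat.zero_le _) hk
    omega
  simp only [prodStat_trig a N hN]
  constructor
  · simp only [← det_aeval_eq_prod_roots]
    refine ((continuous_star.comp continuous_det_U).pow N).mul (Continuous.matrix_det ?_)
    simp only [aeval_eq_sum_range]
    have hpow : ∀ k : ℕ, Continuous fun M : U n => (M : Matrix (Fin n) (Fin n) ℂ) ^ k :=
      fun k => continuous_subtype_val.pow k
    exact continuous_finsetSum _ fun k _ => by
      have h := (hpow k).const_smul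
        ((∑ k ∈ a.support, monomial (k + (N : ℤ)).toNat (a k) : ℂ[X]).coeff k)
      exact h
  · rw [integral_star_det_mul_prod_eval]
    congr 1
    ext i j
    have h2 : fourierCoeffCLM ((i : ℤ) - j) (trigPoly a) =
        a (i - j) := by
      rw [trigPoly, Finsupp.sum, map_sum]
      simp only [map_smul, fourierCoeffCLM_fourier, smul_eq_mul, mul_ite, mul_one, mul_zero]
      rw [Finset.sum_ite_eq]
      split_ifs with h
      · rfl
      · exact (Finsupp.notMem_support_iff.mp h).symm
    rw [toeplitz, Matrix.of_apply, Matrix.of_apply, h2, coeffZ]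
    split_ifs with h0
    · rw [finsetSum_coeff, Finset.sum_eq_single ((i : ℤ) - j)]
      · rw [coeff_monomial, if_pos (by congr 1; ring)]
      · intro k hk hne
        rw [coeff_monomial, if_neg]
        have := hN k hk
        omega
      · intro h
        rw [Finsupp.notMem_support_iff.mp h]
        simp
    · by_contra h
      have := hN ((i : ℤ) - j) (Finsupp.mem_support_iff.mpr (Ne.symm h))
      omega

theorem norm_prodStat_le {g : C(Circ, ℂ)} {R : ℝ} (hg : ‖g‖ ≤ R) (M : U n) :
    ‖prodStat g M‖ ≤ R ^ n := by
  have hcard : Multiset.card (M : Matrix (Fin n) (Fin n) ℂ).charpoly.roots = n := by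
    rw [← (IsAlgClosed.splits (M : Matrix (Fin n) (Fin n) ℂ).charpoly).natDegree_eq_card_roots]
    simp
  have h : ∀ s : Multiset ℂ, ‖(s.map fun z : ℂ => g ((z.arg : ℝ) : Circ)).prod‖ ≤
      R ^ Multiset.card s := by
    intro s
    induction s using Multiset.induction_on with
    | empty => simp
    | cons z s ih =>
      rw [Multiset.map_cons, Multiset.prod_cons, norm_mul, Multiset.card_cons, pow_succ']
      gcongr
      · exact (norm_nonneg _).trans hg
      · exact (g.norm_coe_le_norm _).trans hg
  exact (h _).trans_eq (by rw [hcard])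

theorem continuous_toeplitz : Continuous (toeplitz n) :=
  continuous_pi fun i => continuous_pi fun j => (fourierCoeffCLM ((i : ℤ) - j)).continuous

/-- **Heine–Szegő identity** for the unitary group. -/
theorem integral_prodStat (g : C(Circ, ℂ)) :
    ∫ M : U n, prodStat g M ∂haarU n = (toeplitz n g).det := by
  -- Trigonometric polynomials are uniformly dense, and both sides pass to uniform limits: the left
  -- by dominated convergence, the right by continuity.
  have hmem : g ∈ closure (Submodule.span ℂ (Set.range (@fourier (2 * Real.pi))) :
      Set C(Circ, ℂ)) := by
    rw [← Submodule.topologicalClosure_coe, span_fourier_closure_eq_top]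
    trivial
  obtain ⟨u, hu, hlim⟩ := mem_closure_iff_seq_limit.mp hmem
  have hrep : ∀ k, ∃ a : ℤ →₀ ℂ, trigPoly a = u k := fun k =>
    Finsupp.mem_span_range_iff_exists_finsupp.mp (hu k)
  have hint : ∀ k, Continuous (fun M : U n => prodStat (u k) M) ∧
      ∫ M : U n, prodStat (u k) M ∂haarU n = (toeplitz n (u k)).det := by
    intro k
    obtain ⟨a, ha⟩ := hrep k
    rw [← ha]
    exact integral_prodStat_trig a
  obtain ⟨R, hR⟩ := hlim.norm.bddAbove_range
  have hR' : ∀ k, ‖u k‖ ≤ R := fun k => hR ⟨k, rfl⟩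
  have hleft : Filter.Tendsto (fun k => ∫ M : U n, prodStat (u k) M ∂haarU n) Filter.atTop
      (nhds (∫ M : U n, prodStat g M ∂haarU n)) := by
    refine tendsto_integral_of_dominated_convergence (fun _ => R ^ n)
      (fun k => (hint k).1.aestronglyMeasurable) (integrable_const _)
      (fun k => Filter.Eventually.of_forall fun M => norm_prodStat_le (hR' k) M)
      (Filter.Eventually.of_forall fun M => ?_)
    unfold prodStat
    refine tendsto_multiset_prod _ fun z _ => ?_
    exact ((ContinuousMap.evalCLM ℂ ((z.arg : ℝ) : Circ)).continuous.tendsto g).comp hlim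
  have hright : Filter.Tendsto (fun k => (toeplitz n (u k)).det) Filter.atTop
      (nhds (toeplitz n g).det) :=
    ((continuous_toeplitz.matrix_det).tendsto g).comp hlim
  simp only [(hint _).2] at hleft
  exact tendsto_nhds_unique hleft hright

end HeineSzego


/-! ### Derivatives of log det through the truncated logarithm -/

section LogDet

open scoped Matrix.Norms.L2Operator
open Filter Topology

variable {n : ℕ}

/-- The trace as a continuous linear functional. -/
noncomputable def traceCLM (n : ℕ) : Matrix (Fin n) (Fin n) ℂ →L[ℂ] ℂ :=
  LinearMap.toContinuousLinearMap (Matrix.traceLinearMap (Fin n) ℂ ℂ)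

theorem traceCLM_apply (A : Matrix (Fin n) (Fin n) ℂ) : traceCLM n A = A.trace := rfl

theorem differentiable_det :
    Differentiable ℂ (Matrix.det : Matrix (Fin n) (Fin n) ℂ → ℂ) := by
  have h : (Matrix.det : Matrix (Fin n) (Fin n) ℂ → ℂ) =
      evalEntries (Matrix.det (Matrix.mvPolynomialX (Fin n) (Fin n) ℂ)) := by
    ext A
    exact (Matrix.eval_det_mvPolynomialX (Fin n) ℂ fun x : Fin n × Fin n => A x.1 x.2).symm
  rw [h]
  exact differentiable_evalEntries _

/-- On each line, det(1 + tH) = 1 + t tr H + O(t²). -/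
theorem hasFDerivAt_det_one :
    HasFDerivAt (Matrix.det : Matrix (Fin n) (Fin n) ℂ → ℂ) (traceCLM n) 1 := by
  have h := (differentiable_det (n := n) 1).hasFDerivAt
  have he : fderiv ℂ (Matrix.det : Matrix (Fin n) (Fin n) ℂ → ℂ) 1 = traceCLM n := by
    ext H
    have hline : HasDerivAt (fun t : ℂ => (1 : Matrix (Fin n) (Fin n) ℂ) + t • H) H 0 := by
      simpa using ((hasDerivAt_id (0 : ℂ)).smul_const H).const_add 1
    have h1 : HasDerivAt (fun t : ℂ => ((1 : Matrix (Fin n) (Fin n) ℂ) + t • H).det)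
        (fderiv ℂ (Matrix.det : Matrix (Fin n) (Fin n) ℂ → ℂ) 1 H) 0 := by
      exact h.comp_hasDerivAt_of_eq (0 : ℂ) hline (by simp)
    refine h1.unique ?_
    obtain ⟨e, he⟩ : ∃ e : Polynomial ℂ, ∀ t : ℂ, ((1 : Matrix (Fin n) (Fin n) ℂ) + t • H).det =
        1 + H.trace * t + e.eval t * t ^ 2 := ⟨_, fun t => Matrix.det_one_add_smul t H⟩
    simp only [he]
    have h2 := (((hasDerivAt_id (0 : ℂ)).const_mul H.trace).const_add 1).add
      ((e.hasDerivAt 0).mul (hasDerivAt_pow 2 (0 : ℂ)))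
    convert! h2 using 1
    simp [traceCLM_apply]
  rwa [he] at h

/-- Jacobi's formula, reduced to the derivative at 1 by multiplying by the inverse of T z. -/
theorem hasDerivAt_det {T : ℂ → Matrix (Fin n) (Fin n) ℂ} {T' : Matrix (Fin n) (Fin n) ℂ} {z : ℂ}
    (hT : HasDerivAt T T' z) (hz : (T z).det ≠ 0) :
    HasDerivAt (fun w => (T w).det) ((T z).det * ((T z)⁻¹ * T').trace) z := by
  have hinv : (T z)⁻¹ * T z = 1 := Matrix.nonsing_inv_mul _ (isUnit_iff_ne_zero.mpr hz)
  have h1 : HasDerivAt (fun w => (T z)⁻¹ * T w) ((T z)⁻¹ * T') z := hT.const_mul _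
  have h2 : HasDerivAt (fun w => ((T z)⁻¹ * T w).det) (((T z)⁻¹ * T').trace) z :=
    hasFDerivAt_det_one.comp_hasDerivAt_of_eq z h1 hinv.symm
  have h3 := h2.const_mul (T z).det
  refine h3.congr_of_eventuallyEq (Eventually.of_forall fun w => ?_)
  simp only [Matrix.det_mul, Matrix.det_nonsing_inv, Ring.inverse_eq_inv']
  field_simp

/-- The truncated power series of `tr (log (1 + B))`. -/
noncomputable def logTrunc (n ℓ : ℕ) (B : Matrix (Fin n) (Fin n) ℂ) : ℂ :=
  ∑ m ∈ Finset.range ℓ, ((-1) ^ m / (m + 1 : ℂ)) * (B ^ (m + 1)).trace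

theorem hasDerivAt_trace_pow {A : ℂ → Matrix (Fin n) (Fin n) ℂ} {A' : Matrix (Fin n) (Fin n) ℂ}
    {z : ℂ} (hA : HasDerivAt A A' z) (m : ℕ) :
    HasDerivAt (fun w => (A w ^ (m + 1)).trace) ((m + 1 : ℂ) * (A z ^ m * A').trace) z := by
  have h := (traceCLM n).hasFDerivAt.comp_hasDerivAt z (hA.pow' (m + 1))
  refine h.congr_deriv ?_
  rw [map_sum]
  simp only [traceCLM_apply, Nat.pred_eq_sub_one, Nat.add_sub_cancel]
  rw [Finset.sum_congr rfl (g := fun _ => (A z ^ m * A').trace), Finset.sum_const,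
    Finset.card_range, nsmul_eq_mul]
  · push_cast
    ring
  · intro i hi
    rw [Matrix.mul_assoc, Matrix.trace_mul_comm, Matrix.mul_assoc, ← pow_add, Matrix.trace_mul_comm]
    congr 3
    have := Finset.mem_range.mp hi
    omega

theorem hasDerivAt_logTrunc {A : ℂ → Matrix (Fin n) (Fin n) ℂ} {A' : Matrix (Fin n) (Fin n) ℂ}
    {z : ℂ} (hA : HasDerivAt A A' z) (ℓ : ℕ) :
    HasDerivAt (fun w => logTrunc n ℓ (A w)) ((∑ m ∈ Finset.range ℓ, (-A z) ^ m) * A').trace z := by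
  have h : HasDerivAt (fun w => logTrunc n ℓ (A w))
      (∑ m ∈ Finset.range ℓ, ((-1) ^ m / (m + 1 : ℂ)) * ((m + 1 : ℂ) * (A z ^ m * A').trace)) z :=
    HasDerivAt.fun_sum fun m _ => (hasDerivAt_trace_pow hA m).const_mul _
  refine h.congr_deriv ?_
  rw [Finset.sum_mul, Matrix.trace_sum]
  refine Finset.sum_congr rfl fun m _ => ?_
  have hm : (m + 1 : ℂ) ≠ 0 := by exact_mod_cast Nat.succ_ne_zero m
  rw [← mul_assoc, div_mul_cancel₀ _ hm, ← neg_one_smul ℂ (A z), smul_pow, Matrix.smul_mul,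
    Matrix.trace_smul, smul_eq_mul]

theorem log_deriv_sub_logTrunc_deriv (B T' : Matrix (Fin n) (Fin n) ℂ) (h : (1 + B).det ≠ 0)
    (ℓ : ℕ) :
    ((1 + B)⁻¹ * T').trace - ((∑ m ∈ Finset.range ℓ, (-B) ^ m) * T').trace =
      ((1 + B)⁻¹ * (-B) ^ ℓ * T').trace := by
  have hinv : (1 + B)⁻¹ * (1 + B) = 1 := Matrix.nonsing_inv_mul _ (isUnit_iff_ne_zero.mpr h)
  have hg := mul_neg_geom_sum (-B) ℓ
  rw [sub_neg_eq_add] at hg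
  have h2 : (∑ m ∈ Finset.range ℓ, (-B) ^ m) = (1 + B)⁻¹ * (1 - (-B) ^ ℓ) := by
    rw [← hg, ← Matrix.mul_assoc, hinv, Matrix.one_mul]
  rw [h2, ← Matrix.trace_sub, ← Matrix.sub_mul, Matrix.mul_sub, Matrix.mul_one, sub_sub_cancel]

/-- With B = T - 1, the first derivatives of the two functions differ by tr(T⁻¹(-B)^ℓ T'). As B(0) =
0, this vanishes to order at least ℓ at 0, so its derivative of order ℓ - 1 is zero there. -/
theorem iteratedDeriv_log_det {T : ℂ → Matrix (Fin n) (Fin n) ℂ} (hT : AnalyticAt ℂ T 0)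
    (hT0 : T 0 = 1) {ℓ : ℕ} (hℓ : 1 ≤ ℓ) :
    iteratedDeriv ℓ (fun z => Complex.log (T z).det) 0 =
      iteratedDeriv ℓ (fun z => logTrunc n ℓ (T z - 1)) 0 := by
  have hdetA : AnalyticAt ℂ (fun z => (T z).det) 0 := by
    have h1 : AnalyticAt ℂ (Matrix.det : Matrix (Fin n) (Fin n) ℂ → ℂ) (T 0) := by
      have h : (Matrix.det : Matrix (Fin n) (Fin n) ℂ → ℂ) =
          fun A : Matrix (Fin n) (Fin n) ℂ => ∑ σ : Equiv.Perm (Fin n), (Equiv.Perm.sign σ : ℤ) * ∏ i, A (σ i) i := by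
        ext A
        exact Matrix.det_apply' A
      rw [h]
      refine Finset.analyticAt_fun_sum _ fun σ _ => analyticAt_const.mul
        (Finset.analyticAt_fun_prod _ fun i _ => ?_)
      exact (LinearMap.toContinuousLinearMap
        (Matrix.entryLinearMap ℂ ℂ (σ i) i)).analyticAt _
    exact h1.comp hT
  have hslit : (T 0).det ∈ Complex.slitPlane := by
    rw [hT0, Matrix.det_one]
    exact Complex.one_mem_slitPlane
  have hL : AnalyticAt ℂ (fun z => Complex.log (T z).det) 0 := hdetA.clog hslit
  have hA : AnalyticAt ℂ (fun z => T z - 1) 0 := hT.sub analyticAt_const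
  have hQ : AnalyticAt ℂ (fun z => logTrunc n ℓ (T z - 1)) 0 := by
    unfold logTrunc
    refine Finset.analyticAt_fun_sum _ fun m _ => analyticAt_const.mul ?_
    exact ((traceCLM n).analyticAt _).comp (hA.pow (m + 1))
  obtain ⟨k, rfl⟩ : ∃ k, ℓ = k + 1 := ⟨ℓ - 1, by omega⟩
  have hsub := (hL.fun_sub hQ).deriv
  have horder : ((k + 1 : ℕ) : ℕ∞) ≤ analyticOrderAt (deriv fun z =>
      Complex.log (T z).det - logTrunc n (k + 1) (T z - 1)) 0 := by
    rw [natCast_le_analyticOrderAt hsub]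
    obtain ⟨p, hp⟩ := hA
    -- The slope of T - 1 at 0 is its analytic quotient by z; its powers provide the cofactor of
    -- z^(k+1).
    have hds : AnalyticAt ℂ (dslope (fun z => T z - 1) 0) 0 :=
      ⟨_, hp.has_fpower_series_dslope_fslope⟩
    have hTinv : AnalyticAt ℂ (fun z => Ring.inverse (T z)) 0 := by
      have h1 : AnalyticAt ℂ Ring.inverse (T 0) := by
        rw [hT0]
        exact analyticAt_inverse (𝕜 := ℂ) (1 : (Matrix (Fin n) (Fin n) ℂ)ˣ)
      exact h1.comp hT
    refine ⟨fun z => traceCLM n (Ring.inverse (T z) * (-dslope (fun z => T z - 1) 0 z) ^ (k + 1) *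
      deriv T z), ?_, ?_⟩
    · exact ((traceCLM n).analyticAt _).comp ((hTinv.mul (hds.neg.pow (k + 1))).mul hT.deriv)
    · have hnear : ∀ᶠ z in 𝓝 (0 : ℂ), (T z).det ∈ Complex.slitPlane :=
        hdetA.continuousAt.eventually (Complex.isOpen_slitPlane.mem_nhds hslit)
      filter_upwards [hnear, hT.eventually_analyticAt] with z hz hTz
      have hz0 : (T z).det ≠ 0 := Complex.slitPlane_ne_zero hz
      have hTd := hTz.differentiableAt.hasDerivAt
      have hd1 := (hasDerivAt_det hTd hz0).clog hz
      have hd2 := hasDerivAt_logTrunc (hTd.sub_const 1) (k + 1)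
      have hd := (hd1.sub hd2).deriv
      refine Eq.trans hd ?_
      rw [mul_div_cancel_left₀ _ hz0]
      have h1 : T z = 1 + (T z - 1) := by abel
      have h2 := log_deriv_sub_logTrunc_deriv (T z - 1) (deriv T z) (by rwa [← h1]) (k + 1)
      rw [← h1] at h2
      rw [h2]
      have h3 : T z - 1 = z • dslope (fun z => T z - 1) 0 z := by
        have := sub_smul_dslope (fun z => T z - 1) 0 z
        simp only [hT0, sub_self, sub_zero] at this
        exact this.symm
      conv_lhs => rw [h3]
      rw [← smul_neg, smul_pow, Matrix.mul_smul, Matrix.smul_mul, Matrix.trace_smul, sub_zero,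
        traceCLM_apply, Matrix.nonsing_inv_eq_ringInverse]
  have hzero := (natCast_le_analyticOrderAt_iff_iteratedDeriv_eq_zero hsub).mp horder k
    (Nat.lt_succ_self k)
  rw [← iteratedDeriv_succ'] at hzero
  rw [iteratedDeriv_fun_sub hL.contDiffAt hQ.contDiffAt] at hzero
  exact sub_eq_zero.mp hzero

end LogDet


/-! ### Cumulants as traces of products of Toeplitz matrices -/

section CumulantExpansion

open scoped Matrix.Norms.L2Operator
open Filter Topology

variable {n : ℕ}

/-- The coefficients of the power series `tr (log (1 + B))`, truncated at order `ℓ`. -/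
noncomputable def logTruncSeries (n ℓ : ℕ) :
    FormalMultilinearSeries ℂ (Matrix (Fin n) (Fin n) ℂ) ℂ := fun m =>
  if 1 ≤ m ∧ m ≤ ℓ then ((-1) ^ (m - 1) / (m : ℂ)) •
    (traceCLM n).compContinuousMultilinearMap
      (ContinuousMultilinearMap.mkPiAlgebraFin ℂ m (Matrix (Fin n) (Fin n) ℂ))
  else 0

theorem logTruncSeries_apply {ℓ m : ℕ} (h1 : 1 ≤ m) (h2 : m ≤ ℓ)
    (v : Fin m → Matrix (Fin n) (Fin n) ℂ) :
    logTruncSeries n ℓ m v = ((-1) ^ (m - 1) / (m : ℂ)) * ((List.ofFn v).prod).trace := by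
  rw [logTruncSeries, if_pos ⟨h1, h2⟩]
  rfl

theorem hasFPowerSeriesAt_logTrunc (ℓ : ℕ) :
    HasFPowerSeriesAt (logTrunc n ℓ) (logTruncSeries n ℓ) 0 := by
  refine (HasFiniteFPowerSeriesOnBall.mk' (n := ℓ + 1) (r := ⊤) (fun m hm => ?_) (by simp)
    fun y _ => ?_).toHasFPowerSeriesOnBall.hasFPowerSeriesAt
  · rw [logTruncSeries, if_neg (by omega)]
  · rw [Finset.sum_range_succ', zero_add, logTrunc]
    have h0 : logTruncSeries n ℓ 0 = 0 := by rw [logTruncSeries, if_neg (by omega)]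
    rw [h0]
    simp only [_root_.zero_apply, add_zero]
    refine Finset.sum_congr rfl fun m hm => ?_
    have := Finset.mem_range.mp hm
    rw [logTruncSeries_apply (by omega) (by omega)]
    simp [pow_succ']

theorem iteratedDeriv_eq_of_hasFPowerSeriesAt {g : ℂ → ℂ} {p : FormalMultilinearSeries ℂ ℂ ℂ}
    (h : HasFPowerSeriesAt g p 0) (ℓ : ℕ) :
    iteratedDeriv ℓ g 0 = (ℓ.factorial : ℂ) * p ℓ (fun _ => 1) := by
  obtain ⟨r, hr⟩ := h
  rw [iteratedDeriv_eq_iteratedFDeriv, ← hr.factorial_smul, nsmul_eq_mul]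

/-- Faà di Bruno's formula: Taylor coefficients of a composite are sums over compositions. Since A 0
= 0, the outer series is needed only at 0. -/
theorem iteratedDeriv_logTrunc {A : ℂ → Matrix (Fin n) (Fin n) ℂ}
    {a : ℕ → Matrix (Fin n) (Fin n) ℂ} (hA : ∀ z, HasSum (fun j => z ^ j • a j) (A z))
    (hA0 : A 0 = 0) {ℓ : ℕ} (hℓ : 1 ≤ ℓ) :
    iteratedDeriv ℓ (fun z => logTrunc n ℓ (A z)) 0 = (ℓ.factorial : ℂ) *
      ∑ c : Composition ℓ, ((-1) ^ (c.length - 1) / (c.length : ℂ)) *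
        ((List.ofFn fun i => a (c.blocksFun i)).prod).trace := by
  set p : FormalMultilinearSeries ℂ ℂ (Matrix (Fin n) (Fin n) ℂ) := fun j =>
    ContinuousMultilinearMap.mkPiRing ℂ (Fin j) (a j) with hp
  have hpA : HasFPowerSeriesAt A p 0 := by
    rw [hasFPowerSeriesAt_iff]
    refine Eventually.of_forall fun z => ?_
    simpa [FormalMultilinearSeries.coeff, hp] using hA z
  have hQ : HasFPowerSeriesAt (logTrunc n ℓ) (logTruncSeries n ℓ) (A 0) := by
    rw [hA0]
    exact hasFPowerSeriesAt_logTrunc ℓ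
  have hcomp := hQ.comp hpA
  have h := iteratedDeriv_eq_of_hasFPowerSeriesAt hcomp ℓ
  refine h.trans ?_
  congr 1
  rw [FormalMultilinearSeries.comp, _root_.sum_apply]
  refine Finset.sum_congr rfl fun c _ => ?_
  have h1 : 1 ≤ c.length := c.length_pos_of_pos hℓ
  rw [FormalMultilinearSeries.compAlongComposition_apply, logTruncSeries_apply h1 c.length_le]
  congr 4
  funext i
  simp [FormalMultilinearSeries.applyComposition, hp]

/-- The Toeplitz matrix as a continuous linear map of the symbol. -/
noncomputable def toeplitzCLM (n : ℕ) : C(Circ, ℂ) →L[ℂ] Matrix (Fin n) (Fin n) ℂ where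
  toFun := toeplitz n
  map_add' g h := by
    ext i j
    simp [toeplitz]
  map_smul' c g := by
    ext i j
    simp [toeplitz]
  cont := continuous_toeplitz

theorem toeplitzCLM_apply (g : C(Circ, ℂ)) : toeplitzCLM n g = toeplitz n g := rfl

theorem toeplitz_one : toeplitz n 1 = 1 := by
  have h : (1 : C(Circ, ℂ)) = fourier 0 := by
    ext x
    exact fourier_zero.symm
  ext i j
  rw [toeplitz, Matrix.of_apply, h, fourierCoeffCLM_fourier, Matrix.one_apply]
  simp [sub_eq_zero, Fin.ext_iff]

theorem hasSum_toeplitz_exp (F : C(Circ, ℂ)) (z : ℂ) :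
    HasSum (fun j : ℕ => z ^ j • ((j.factorial : ℂ)⁻¹ • toeplitz n (F ^ j)))
      (toeplitz n (NormedSpace.exp (z • F))) := by
  have h := (toeplitzCLM n).hasSum (NormedSpace.exp_series_hasSum_exp' (𝕂 := ℂ) (z • F))
  have he : (fun j : ℕ => z ^ j • ((j.factorial : ℂ)⁻¹ • toeplitz n (F ^ j))) =
      fun j : ℕ => toeplitzCLM n ((j.factorial : ℂ)⁻¹ • (z • F) ^ j) := by
    funext j
    rw [map_smul, smul_pow, map_smul, toeplitzCLM_apply, smul_comm]
  rw [he]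
  exact h

theorem hasSum_toeplitz_exp_sub_one (F : C(Circ, ℂ)) (z : ℂ) :
    HasSum (fun j : ℕ => z ^ j • if j = 0 then 0 else (j.factorial : ℂ)⁻¹ • toeplitz n (F ^ j))
      (toeplitz n (NormedSpace.exp (z • F)) - 1) := by
  have h := (hasSum_toeplitz_exp (n := n) F z).sub
    (hasSum_ite_eq 0 (1 : Matrix (Fin n) (Fin n) ℂ))
  have he : (fun j : ℕ => z ^ j • if j = 0 then 0 else
      (j.factorial : ℂ)⁻¹ • toeplitz n (F ^ j)) = fun j : ℕ =>
      z ^ j • ((j.factorial : ℂ)⁻¹ • toeplitz n (F ^ j)) -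
        if j = 0 then (1 : Matrix (Fin n) (Fin n) ℂ) else 0 := by
    funext j
    split_ifs with hj
    · subst hj
      simp [toeplitz_one]
    · rw [sub_zero]
  rw [he]
  exact h

theorem exp_smul_apply (F : C(Circ, ℂ)) (z : ℂ) (x : Circ) :
    NormedSpace.exp (z • F) x = Complex.exp (z * F x) := by
  have h1 := (ContinuousMap.evalCLM ℂ x).hasSum
    (NormedSpace.exp_series_hasSum_exp' (𝕂 := ℂ) (z • F))
  have h2 := NormedSpace.exp_series_hasSum_exp' (𝕂 := ℂ) (z * F x)
  rw [← Complex.exp_eq_exp_ℂ] at h2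
  refine h1.unique ?_
  simpa using h2

theorem prodStat_exp (F : C(Circ, ℂ)) (z : ℂ) (M : U n) :
    prodStat (NormedSpace.exp (z • F) : C(Circ, ℂ)) M = Complex.exp (z * linStat n F M) := by
  rw [prodStat, linStat, ← Multiset.sum_map_mul_left, Complex.exp_multiset_sum, Multiset.map_map]
  exact congrArg _ (Multiset.map_congr rfl fun w _ => exp_smul_apply F z _)

theorem list_prod_smul : ∀ (m : ℕ) (a : Fin m → ℂ) (B : Fin m → Matrix (Fin n) (Fin n) ℂ),
    (List.ofFn fun i => a i • B i).prod = (∏ i, a i) • (List.ofFn B).prod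
  | 0, _, _ => by simp
  | m + 1, a, B => by
    rw [List.ofFn_succ, List.prod_cons, list_prod_smul m, List.ofFn_succ, List.prod_cons,
      Fin.prod_univ_succ, smul_mul_smul_comm]

/-- The cumulants of a linear statistic, in terms of traces of products of Toeplitz matrices. -/
theorem cumulant_linStat (F : C(Circ, ℂ)) {ℓ : ℕ} (hℓ : 1 ≤ ℓ) :
    cumulant (haarU n) (linStat n F) ℓ = (ℓ.factorial : ℂ) *
      ∑ c : Composition ℓ, ((-1) ^ (c.length - 1) / (c.length : ℂ)) *
        ((∏ i, ((c.blocksFun i).factorial : ℂ))⁻¹ *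
          ((List.ofFn fun i => toeplitz n (F ^ c.blocksFun i)).prod).trace) := by
  have h1 : cumulant (haarU n) (linStat n F) ℓ =
      iteratedDeriv ℓ (fun z : ℂ => Complex.log (toeplitz n (NormedSpace.exp (z • F))).det) 0 := by
    simp only [cumulant, ← prodStat_exp, integral_prodStat]
  have h0 : toeplitz n (NormedSpace.exp ((0 : ℂ) • F)) = 1 := by
    rw [zero_smul, NormedSpace.exp_zero, toeplitz_one]
  have hT : AnalyticAt ℂ (fun z : ℂ => toeplitz n (NormedSpace.exp (z • F))) 0 := by
    set p : FormalMultilinearSeries ℂ ℂ (Matrix (Fin n) (Fin n) ℂ) := fun j =>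
      ContinuousMultilinearMap.mkPiRing ℂ (Fin j) ((j.factorial : ℂ)⁻¹ • toeplitz n (F ^ j))
      with hp
    refine ⟨p, ?_⟩
    rw [hasFPowerSeriesAt_iff]
    refine Eventually.of_forall fun z => ?_
    simpa [FormalMultilinearSeries.coeff, hp] using hasSum_toeplitz_exp (n := n) F z
  rw [h1, iteratedDeriv_log_det hT h0 hℓ, iteratedDeriv_logTrunc
    (hasSum_toeplitz_exp_sub_one F) (by rw [h0, sub_self]) hℓ]
  congr 1
  refine Finset.sum_congr rfl fun c _ => ?_
  congr 1
  have hb : ∀ i, (if c.blocksFun i = 0 then 0 else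
      ((c.blocksFun i).factorial : ℂ)⁻¹ • toeplitz n (F ^ c.blocksFun i)) =
      ((c.blocksFun i).factorial : ℂ)⁻¹ • toeplitz n (F ^ c.blocksFun i) := fun i =>
    if_neg (Nat.one_le_iff_ne_zero.mp (c.one_le_blocksFun i))
  simp only [hb]
  rw [list_prod_smul, Matrix.trace_smul, Finset.prod_inv_distrib, smul_eq_mul]

end CumulantExpansion


/-! ### Products of absolutely convergent series -/

section MultipleSeries

/-- The product of finitely many absolutely convergent series in a Banach algebra. -/
theorem hasSum_list_prod_ofFn {𝔸 : Type*} [NormedRing 𝔸] [CompleteSpace 𝔸] :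
    ∀ (m : ℕ) (ι : Fin m → Type) (x : ∀ i, ι i → 𝔸) (s : Fin m → 𝔸),
      (∀ i, Summable fun k => ‖x i k‖) → (∀ i, HasSum (x i) (s i)) →
      (Summable fun k : ∀ i, ι i => ‖(List.ofFn fun i => x i (k i)).prod‖) ∧
      HasSum (fun k : ∀ i, ι i => (List.ofFn fun i => x i (k i)).prod) (List.ofFn s).prod := by
  intro m
  induction m with
  | zero =>
    intro ι x s _ _
    simp only [List.ofFn_zero, List.prod_nil]
    refine ⟨(hasSum_fintype _).summable, ?_⟩
    convert! hasSum_fintype (fun _ : ∀ i : Fin 0, ι i => (1 : 𝔸)) using 1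
    simp
  | succ m ih =>
    intro ι x s hx hs
    obtain ⟨h1, h2⟩ := ih (fun i => ι i.succ) (fun i => x i.succ) (fun i => s i.succ)
      (fun i => hx i.succ) (fun i => hs i.succ)
    rw [← (Fin.consEquiv ι).summable_iff, ← (Fin.consEquiv ι).hasSum_iff]
    have he : ((fun k : ∀ i, ι i => (List.ofFn fun i => x i (k i)).prod) ∘ Fin.consEquiv ι) =
        fun q : ι 0 × (∀ i : Fin m, ι i.succ) =>
          x 0 q.1 * (List.ofFn fun i => x i.succ (q.2 i)).prod := by
      funext q
      simp [Fin.consEquiv]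
    have hn := (hx 0).mul_norm h1
    refine ⟨?_, ?_⟩
    · refine hn.congr fun q => ?_
      exact congrArg norm (congrFun he q).symm
    · rw [he, List.ofFn_succ, List.prod_cons, ← (hs 0).tsum_eq, ← h2.tsum_eq,
        tsum_mul_tsum_of_summable_norm (hx 0) h1]
      exact hn.of_norm.hasSum

theorem summable_prod_of_summable {m : ℕ} {u : Fin m → ℤ → ℝ}
    (hu : ∀ i, Summable (u i)) : Summable fun k : Fin m → ℤ => ∏ i, u i (k i) := by
  have h := (hasSum_list_prod_ofFn m (fun _ => ℤ) u (fun i => ∑' k, u i k)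
    (fun i => (hu i).norm) (fun i => (hu i).hasSum)).2.summable
  refine h.congr fun k => ?_
  rw [List.prod_ofFn]

end MultipleSeries

/-! ### Traces of products of truncated shifts -/

section TraceExpansion

variable {n : ℕ}

theorem toeplitz_fourier_apply (b : ℤ) (i j : Fin n) :
    toeplitz n (fourier b) i j = if (i : ℤ) - j = b then 1 else 0 := by
  rw [toeplitz, Matrix.of_apply, fourierCoeffCLM_fourier]

/-- Each factor is a shift truncated to {0,…,n-1}, so the product follows the path i - (P s - P 0)
and dies once it leaves the window. Induction peels off the first step, hence the generalization
over P and i. -/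
theorem list_prod_toeplitz_fourier (m : ℕ) (P : ℕ → ℤ) (i j : Fin n) :
    (List.ofFn fun s : Fin m => toeplitz n (fourier (P (s + 1) - P s))).prod i j =
      if (∀ s ≤ m, 0 ≤ (i : ℤ) - (P s - P 0) ∧ (i : ℤ) - (P s - P 0) < n) ∧
        (i : ℤ) - (P m - P 0) = j then 1 else 0 := by
  induction m generalizing P i with
  | zero =>
    simp only [List.ofFn_zero, List.prod_nil, Matrix.one_apply]
    congr 1
    refine propext ⟨?_, ?_⟩
    · rintro rfl
      refine ⟨fun s hs => ?_, by simp⟩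
      obtain rfl : s = 0 := by omega
      omega
    · rintro ⟨_, h⟩
      exact Fin.ext (by omega)
  | succ m ih =>
    rw [List.ofFn_succ, List.prod_cons, Matrix.mul_apply]
    have ih' := fun l => ih (fun s => P (s + 1)) l
    simp only [Fin.val_succ, Fin.val_zero, zero_add, toeplitz_fourier_apply]
    simp only [ih', ite_mul, one_mul, zero_mul]
    by_cases hl : 0 ≤ (i : ℤ) - (P 1 - P 0) ∧ (i : ℤ) - (P 1 - P 0) < n
    · obtain ⟨l, hl'⟩ : ∃ l : Fin n, (l : ℤ) = i - (P 1 - P 0) :=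
        ⟨⟨((i : ℤ) - (P 1 - P 0)).toNat, by omega⟩, by simp; omega⟩
      rw [Finset.sum_eq_single l, if_pos (by omega)]
      · congr 1
        refine propext (and_congr ⟨fun h s hs => ?_, fun h s hs => ?_⟩ ?_)
        · rcases s with _ | s
          · omega
          · have := h s (by omega)
            simp only [zero_add] at this
            omega
        · have := h (s + 1) (by omega)
          simp only [zero_add]
          omega
        · simp only [zero_add]
          omega
      · intro b _ hb
        rw [if_neg]
        intro h
        exact hb (Fin.ext (by omega))
      · simp
    · rw [Finset.sum_eq_zero, if_neg]
      · rintro ⟨h, _⟩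
        exact hl (h 1 (by omega))
      · intro b _
        rw [if_neg]
        omega

theorem card_filter_window (n : ℕ) (a b : ℤ) (ha : 0 ≤ a) (hb : 0 ≤ b) :
    (Finset.univ.filter fun i : Fin n => a ≤ (i : ℤ) ∧ b ≤ n - 1 - (i : ℤ)).card =
      ((n : ℤ) - a - b).toNat := by
  have h : (Finset.univ.filter fun i : Fin n => a ≤ (i : ℤ) ∧ b ≤ n - 1 - (i : ℤ)).map
      Fin.valEmbedding = Finset.Ico a.toNat ((n : ℤ) - b).toNat := by
    ext x
    simp only [Finset.mem_map, Finset.mem_filter, Finset.mem_univ, true_and, Fin.valEmbedding_apply,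
      Finset.mem_Ico]
    constructor
    · rintro ⟨i, hi, rfl⟩
      omega
    · intro hx
      exact ⟨⟨x, by omega⟩, by simp only; omega, rfl⟩
  rw [← Finset.card_map Fin.valEmbedding, h, Nat.card_Ico]
  omega

/-- A closed path from i stays in the window exactly when max(0, P) ≤ i ≤ n - 1 - max(0, -P). The
ends s = 0 and s = m require only 0 ≤ i < n, and `toNat` covers an empty range of i. -/
theorem trace_list_prod_toeplitz_fourier (m : ℕ) (P : ℕ → ℤ) (hP : P 0 = 0) :
    ((List.ofFn fun s : Fin m => toeplitz n (fourier (P (s + 1) - P s))).prod).trace =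
      if P m = 0 then ((((n : ℤ) - (Finset.Ico 1 m).fold max 0 P -
        (Finset.Ico 1 m).fold max 0 (fun j => -P j)).toNat : ℕ) : ℂ) else 0 := by
  simp only [Matrix.trace, Matrix.diag_apply, list_prod_toeplitz_fourier, hP, sub_zero]
  split_ifs with hm
  · rw [Finset.sum_boole]
    congr 1
    rw [← card_filter_window n _ _ (Finset.le_fold_max 0 |>.mpr (Or.inl le_rfl))
      (Finset.le_fold_max 0 |>.mpr (Or.inl le_rfl))]
    congr 1
    ext i
    simp only [Finset.mem_filter, Finset.mem_univ, true_and, Finset.fold_max_le, Finset.mem_Ico]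
    constructor
    · rintro ⟨h, _⟩
      refine ⟨⟨by omega, fun s hs => ?_⟩, by omega, fun s hs => ?_⟩ <;>
      · have := h s (by omega)
        omega
    · rintro ⟨⟨_, h1⟩, _, h2⟩
      refine ⟨fun s hs => ?_, by omega⟩
      rcases Nat.eq_zero_or_pos s with rfl | hs0
      · rw [hP]
        omega
      · rcases hs.eq_or_lt with rfl | hs1
        · rw [hm]
          omega
        · have := h1 s ⟨hs0, hs1⟩
          have := h2 s ⟨hs0, hs1⟩
          omega
  · refine Finset.sum_eq_zero fun i _ => if_neg ?_
    rintro ⟨_, h⟩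
    omega

end TraceExpansion

/-! ### Fourier expansion of the traces -/

section Expansion

variable {n ℓ : ℕ}

theorem partialSum_zero (k : Fin ℓ → ℤ) : partialSum k 0 = 0 := by simp [partialSum]

theorem partialSum_self (k : Fin ℓ → ℤ) : partialSum k ℓ = ∑ i, k i := by simp [partialSum]

theorem partialSum_neg (k : Fin ℓ → ℤ) (s : ℕ) :
    partialSum (fun i => -k i) s = -partialSum k s := by simp [partialSum]

/-- Puts the frequency of a block into the increment form used for products of shifts. -/
theorem sum_block (c : Composition ℓ) (k : Fin ℓ → ℤ) (s : Fin c.length) :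
    ∑ j, k (c.embedding s j) =
      partialSum k (c.sizeUpTo (s + 1)) - partialSum k (c.sizeUpTo s) := by
  have h1 : ∑ j, k (c.embedding s j) = ∑ i ∈ Finset.univ.filter fun i : Fin ℓ =>
      c.sizeUpTo s ≤ i ∧ (i : ℕ) < c.sizeUpTo (s + 1), k i := by
    have : (Finset.univ.filter fun i : Fin ℓ =>
        c.sizeUpTo s ≤ i ∧ (i : ℕ) < c.sizeUpTo (s + 1)) =
        Finset.univ.map (c.embedding s).toEmbedding := by
      ext i
      simpa using (c.mem_range_embedding_iff (j := i) (i := s)).symm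
    rw [this, Finset.sum_map]
    rfl
  have hle : c.sizeUpTo s ≤ c.sizeUpTo (s + 1) := c.monotone_sizeUpTo (Nat.le_succ _)
  rw [h1, eq_sub_iff_add_eq, partialSum, partialSum, ← Finset.sum_union]
  · congr 1
    ext i
    simp only [Finset.mem_union, Finset.mem_filter, Finset.mem_univ, true_and]
    omega
  · rw [Finset.disjoint_filter]
    intro i _ h
    omega

/-- The number of admissible starting points of a closed path with steps `k` grouped by `c`. -/
noncomputable def pathCount (n : ℕ) (c : Composition ℓ) (k : Fin ℓ → ℤ) : ℕ :=
  ((n : ℤ) - maxPartial c k - maxPartial c (fun i => -k i)).toNat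

theorem trace_prod_shift (c : Composition ℓ) (k : Fin ℓ → ℤ) :
    ((List.ofFn fun s : Fin c.length =>
      toeplitz n (fourier (∑ j, k (c.embedding s j)))).prod).trace =
      if ∑ i, k i = 0 then (pathCount n c k : ℂ) else 0 := by
  have h := trace_list_prod_toeplitz_fourier (n := n) c.length
    (fun s => partialSum k (c.sizeUpTo s)) (by simp [partialSum_zero])
  simp only [sum_block]
  rw [h, c.sizeUpTo_length, partialSum_self]
  simp only [pathCount, maxPartial, partialSum_neg]

theorem hasSum_pow (F : C(Circ, ℂ)) (hF : Summable (fourierCoeff F)) (l : ℕ) :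
    (Summable fun k : Fin l → ℤ =>
      ‖(∏ i, fourierCoeff F (k i)) • (fourier (∑ i, k i) : C(Circ, ℂ))‖) ∧
    HasSum (fun k : Fin l → ℤ =>
      (∏ i, fourierCoeff F (k i)) • (fourier (∑ i, k i) : C(Circ, ℂ))) (F ^ l) := by
  have hn : Summable fun k => ‖fourierCoeff F k • (fourier k : C(Circ, ℂ))‖ := by
    refine hF.norm.congr fun k => ?_
    rw [norm_smul, fourier_norm, mul_one]
  have h := hasSum_list_prod_ofFn l (fun _ => ℤ)
    (fun _ k => fourierCoeff F k • (fourier k : C(Circ, ℂ))) (fun _ => F) (fun _ => hn)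
    (fun _ => hasSum_fourier_series_of_summable hF)
  have he : ∀ k : Fin l → ℤ,
      (List.ofFn fun i => fourierCoeff F (k i) • (fourier (k i) : C(Circ, ℂ))).prod =
      (∏ i, fourierCoeff F (k i)) • (fourier (∑ i, k i) : C(Circ, ℂ)) := by
    intro k
    ext x
    rw [List.prod_ofFn, ContinuousMap.coe_prod, Finset.prod_apply]
    simp only [ContinuousMap.smul_apply, smul_eq_mul, Finset.prod_mul_distrib]
    congr 1
    induction (Finset.univ : Finset (Fin l)) using Finset.induction_on with
    | empty => simp
    | insert a s ha ih => rw [Finset.prod_insert ha, Finset.sum_insert ha, ih, fourier_add]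
  simp only [he, List.ofFn_const, List.prod_replicate] at h
  exact h

open scoped Matrix.Norms.L2Operator in
theorem hasSum_trace_prod_toeplitz (F : C(Circ, ℂ)) (hF : Summable (fourierCoeff F))
    (c : Composition ℓ) :
    HasSum (fun k : {k : Fin ℓ → ℤ // ∑ i, k i = 0} =>
        (∏ i, fourierCoeff F (k.1 i)) * (pathCount n c k.1 : ℂ))
      ((List.ofFn fun i => toeplitz n (F ^ c.blocksFun i)).prod).trace := by
  have hblock : ∀ l : ℕ, (Summable fun k : Fin l → ℤ =>
      ‖(∏ i, fourierCoeff F (k i)) • toeplitz n (fourier (∑ i, k i))‖) ∧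
      HasSum (fun k : Fin l → ℤ =>
      (∏ i, fourierCoeff F (k i)) • toeplitz n (fourier (∑ i, k i))) (toeplitz n (F ^ l)) := by
    intro l
    obtain ⟨h1, h2⟩ := hasSum_pow F hF l
    constructor
    · refine Summable.of_nonneg_of_le (fun _ => norm_nonneg _) (fun k => ?_)
        (h1.mul_left ‖toeplitzCLM n‖)
      rw [← toeplitzCLM_apply, ← map_smul]
      exact (toeplitzCLM n).le_opNorm _
    · have := (toeplitzCLM n).hasSum h2
      simp only [map_smul] at this
      exact this
  have h := (hasSum_list_prod_ofFn c.length (fun i => Fin (c.blocksFun i) → ℤ)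
    (fun i k => (∏ j, fourierCoeff F (k j)) • toeplitz n (fourier (∑ j, k j)))
    (fun i => toeplitz n (F ^ c.blocksFun i)) (fun i => (hblock _).1) (fun i => (hblock _).2)).2
  have h' := (traceCLM n).hasSum h
  -- Cutting k into the blocks of c merges the multiple series into one over ℤ^ℓ.
  let e : (Fin ℓ → ℤ) ≃ (∀ i, Fin (c.blocksFun i) → ℤ) :=
    (Equiv.arrowCongr c.blocksFinEquiv.symm (Equiv.refl ℤ)).trans (Equiv.piCurry fun _ _ => ℤ)
  have he : ∀ k i j, e k i j = k (c.embedding i j) := fun k i j => rfl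
  rw [← e.hasSum_iff] at h'
  have hfun : ∀ k : Fin ℓ → ℤ, traceCLM n (List.ofFn fun i =>
      (∏ j, fourierCoeff F (e k i j)) • toeplitz n (fourier (∑ j, e k i j))).prod =
      (∏ i, fourierCoeff F (k i)) * if ∑ i, k i = 0 then (pathCount n c k : ℂ) else 0 := by
    intro k
    simp only [he]
    rw [list_prod_smul, traceCLM_apply, Matrix.trace_smul, trace_prod_shift,
      c.prod_prod_apply_embedding (fun i => fourierCoeff F (k i)), smul_eq_mul]
  have h'' : HasSum (fun k : Fin ℓ → ℤ => (∏ i, fourierCoeff F (k i)) *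
      if ∑ i, k i = 0 then (pathCount n c k : ℂ) else 0)
      ((List.ofFn fun i => toeplitz n (F ^ c.blocksFun i)).prod).trace := by
    rw [← funext hfun]
    exact h'
  rw [← hasSum_subtype_iff_of_support_subset (s := {k : Fin ℓ → ℤ | ∑ i, k i = 0})] at h''
  · convert! h'' using 1
    funext k
    have := k.2
    simp [this]
  · intro k hk
    by_contra h0
    exact hk (by simp only [Set.mem_ofPred_eq] at h0; simp [h0])

end Expansion


/-! ### Fourier coefficients of C¹ functions -/

section Regularity

variable {f : Circ → ℂ}

theorem continuous_of_contDiff (hf : ContDiff ℝ 1 fun x : ℝ => f (x : Circ)) : Continuous f :=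
  (QuotientAddGroup.isQuotientMap_mk (N := AddSubgroup.zmultiples (2 * Real.pi))).continuous_iff.2
    hf.continuous

theorem fourierCoeffOn_comp_coe (k : ℤ) :
    fourierCoeffOn Real.two_pi_pos (fun x : ℝ => f (x : Circ)) k = fourierCoeff f k := by
  rw [fourierCoeffOn_eq_integral, fourierCoeff_eq_intervalIntegral f k 0, sub_zero, zero_add]

/-- Integration by parts; periodicity kills the boundary term. -/
theorem norm_fourierCoeffOn_deriv (hf : ContDiff ℝ 1 fun x : ℝ => f (x : Circ)) {k : ℤ}
    (hk : k ≠ 0) :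
    ‖fourierCoeffOn Real.two_pi_pos (deriv fun x : ℝ => f (x : Circ)) k‖ =
      |(k : ℝ)| * ‖fourierCoeff f k‖ := by
  have h := fourierCoeffOn_of_hasDerivAt Real.two_pi_pos hk
    (fun x _ => (hf.differentiable one_ne_zero x).hasDerivAt)
    ((hf.continuous_deriv le_rfl).intervalIntegrable 0 (2 * Real.pi))
  have hper : f ((2 * Real.pi : ℝ) : Circ) = f ((0 : ℝ) : Circ) := by
    rw [AddCircle.coe_period, AddCircle.coe_zero]
  rw [fourierCoeffOn_comp_coe, hper, sub_self, mul_zero, zero_sub] at h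
  have hk' : |(k : ℝ)| ≠ 0 := abs_ne_zero.2 (Int.cast_ne_zero.2 hk)
  have hpi := Real.pi_pos
  rw [h]
  simp only [norm_mul, norm_div, norm_neg, norm_one, Complex.norm_I, Complex.norm_intCast,
    Complex.ofReal_zero, sub_zero, Complex.norm_real, Real.norm_eq_abs, Complex.norm_ofNat,
    abs_of_pos hpi, Complex.ofReal_mul, Complex.ofReal_ofNat]
  field_simp

/-- Parseval for the derivative, which is bounded and so square integrable over a period. -/
theorem summable_sq_mul_fourierCoeff (hf : ContDiff ℝ 1 fun x : ℝ => f (x : Circ)) :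
    Summable fun k : ℤ => (|(k : ℝ)| * ‖fourierCoeff f k‖) ^ 2 := by
  have hc := hf.continuous_deriv le_rfl
  have hL2 : MemLp (deriv fun x : ℝ => f (x : Circ)) 2
      (volume.restrict (Set.Ioc 0 (2 * Real.pi))) := by
    obtain ⟨C, hC⟩ := (isCompact_Icc (a := (0 : ℝ)) (b := 2 * Real.pi)).exists_bound_of_continuousOn
      hc.continuousOn
    refine MemLp.of_bound hc.aestronglyMeasurable C ?_
    filter_upwards [ae_restrict_mem measurableSet_Ioc] with x hx
    exact hC x (Set.Ioc_subset_Icc_self hx)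
  refine Summable.of_nonneg_of_le (fun _ => by positivity) (fun k => ?_)
    (hasSum_sq_fourierCoeffOn Real.two_pi_pos hL2).summable
  rcases eq_or_ne k 0 with rfl | hk
  · simp
  · rw [norm_fourierCoeffOn_deriv hf hk]

/-- For k ≠ 0, |f̂(k)| = |k|⁻¹ · |k||f̂(k)| ≤ k⁻² + (|k||f̂(k)|)². -/
theorem summable_norm_fourierCoeff (hf : ContDiff ℝ 1 fun x : ℝ => f (x : Circ)) :
    Summable fun k : ℤ => ‖fourierCoeff f k‖ := by
  have h1 : Summable fun k : ℤ => 1 / (k : ℝ) ^ 2 :=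
    Real.summable_one_div_int_pow.2 one_lt_two
  have h2 : Summable fun k : ℤ => if k = 0 then ‖fourierCoeff f 0‖ else 0 :=
    (hasSum_ite_eq (0 : ℤ) ‖fourierCoeff f 0‖).summable
  refine Summable.of_nonneg_of_le (fun _ => norm_nonneg _) (fun k => ?_)
    (h2.add (h1.add (summable_sq_mul_fourierCoeff hf)))
  rcases eq_or_ne k 0 with rfl | hk
  · simp
  · have hk' : 0 < |(k : ℝ)| := abs_pos.2 (Int.cast_ne_zero.2 hk)
    have h3 : 1 / (k : ℝ) ^ 2 = (1 / |(k : ℝ)|) ^ 2 := by rw [div_pow, sq_abs, one_pow]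
    have h4 : ‖fourierCoeff f k‖ = 1 / |(k : ℝ)| * (|(k : ℝ)| * ‖fourierCoeff f k‖) := by
      field_simp
    rw [if_neg hk, zero_add, h3]
    generalize |(k : ℝ)| * ‖fourierCoeff f k‖ = y at *
    rw [h4]
    nlinarith [two_mul_le_add_sq (1 / |(k : ℝ)|) y, sq_nonneg (1 / |(k : ℝ)|), sq_nonneg y]

end Regularity

/-! ### Summability on the hyperplane ∑ k_i = 0 -/

section Hyperplane

variable {ℓ : ℕ}

/-- On the hyperplane the coordinate i₀ is determined by the others, so it needs no decay. -/
theorem summable_prod_hyperplane {u : Fin ℓ → ℤ → ℝ} (i₀ : Fin ℓ) (h₀ : u i₀ = 1)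
    (hu : ∀ i ≠ i₀, Summable (u i)) :
    Summable fun k : {k : Fin ℓ → ℤ // ∑ i, k i = 0} => ∏ i, u i (k.1 i) := by
  obtain _ | m := ℓ
  · exact i₀.elim0
  have h := summable_prod_of_summable (u := fun i => u (i₀.succAbove i))
    fun i => hu _ (Fin.succAbove_ne i₀ i)
  have hinj : Function.Injective fun (k : {k : Fin (m + 1) → ℤ // ∑ i, k i = 0}) =>
      fun i => k.1 (i₀.succAbove i) := by
    rintro ⟨k, hk⟩ ⟨k', hk'⟩ he
    refine Subtype.ext (funext fun i => ?_)
    have he' : ∀ i, k (i₀.succAbove i) = k' (i₀.succAbove i) := fun i => congrFun he i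
    rw [Fin.sum_univ_succAbove _ i₀] at hk hk'
    simp only [he'] at hk
    rcases Fin.eq_self_or_eq_succAbove i₀ i with rfl | ⟨j, rfl⟩
    · change k i = k' i
      omega
    · exact he' j
  refine (h.comp_injective hinj).congr fun k => ?_
  rw [Fin.prod_univ_succAbove _ i₀, h₀, Pi.one_apply, one_mul]
  rfl

/-- The sequence |k| a(k) is only square summable. For a second coordinate j', |k_j| a(k_j) a(k_j')
≤ (|k_j| a(k_j))² + a(k_j')², and each term leaves one coordinate unweighted, which the hyperplane
allows. -/
theorem summable_abs_mul_prod_hyperplane {a : ℤ → ℝ} (h0 : ∀ k, 0 ≤ a k) (ha : Summable a)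
    (ha2 : Summable fun k : ℤ => (|(k : ℝ)| * a k) ^ 2) (j : Fin ℓ) :
    Summable fun k : {k : Fin ℓ → ℤ // ∑ i, k i = 0} => |(k.1 j : ℝ)| * ∏ i, a (k.1 i) := by
  by_cases hj : ∃ j', j' ≠ j
  · obtain ⟨j', hj'⟩ := hj
    have hsq : Summable fun k => a k ^ 2 := by
      refine Summable.of_nonneg_of_le (fun _ => by positivity) (fun k => ?_)
        (ha.mul_left (∑' k, a k))
      rw [sq]
      exact mul_le_mul_of_nonneg_right (ha.le_tsum k fun i _ => h0 i) (h0 k)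
    let u : Fin ℓ → ℤ → ℝ := fun i => if i = j then fun k => (|(k : ℝ)| * a k) ^ 2 else
      if i = j' then 1 else a
    let v : Fin ℓ → ℤ → ℝ := fun i => if i = j then 1 else
      if i = j' then fun k => a k ^ 2 else a
    have hu := summable_prod_hyperplane (u := u) j' (by simp [u, hj']) fun i hi => by
      by_cases h : i = j <;> simp [u, h, hi, ha, ha2]
    have hv := summable_prod_hyperplane (u := v) j (by simp [v]) fun i hi => by
      by_cases h : i = j' <;> simp [v, h, hi, hj', ha, hsq]
    refine Summable.of_nonneg_of_le
      (fun k => mul_nonneg (abs_nonneg _) (Finset.prod_nonneg fun i _ => h0 _)) (fun k => ?_)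
      (hu.add hv)
    have hsplit : ∀ w : Fin ℓ → ℝ, ∏ i, w i =
        w j * (w j' * ∏ i ∈ (Finset.univ.erase j).erase j', w i) := fun w => by
      rw [Finset.mul_prod_erase _ _ (by simp [hj']), Finset.mul_prod_erase _ _ (Finset.mem_univ _)]
    rw [hsplit, hsplit (fun i => u i (k.1 i)), hsplit (fun i => v i (k.1 i))]
    have hru : ∏ i ∈ (Finset.univ.erase j).erase j', u i (k.1 i) =
        ∏ i ∈ (Finset.univ.erase j).erase j', a (k.1 i) := Finset.prod_congr rfl fun i hi => by
      simp only [Finset.mem_erase] at hi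
      simp [u, hi.1, hi.2.1]
    have hrv : ∏ i ∈ (Finset.univ.erase j).erase j', v i (k.1 i) =
        ∏ i ∈ (Finset.univ.erase j).erase j', a (k.1 i) := Finset.prod_congr rfl fun i hi => by
      simp only [Finset.mem_erase] at hi
      simp [v, hi.1, hi.2.1]
    rw [hru, hrv]
    have hr : 0 ≤ ∏ i ∈ (Finset.univ.erase j).erase j', a (k.1 i) :=
      Finset.prod_nonneg fun i _ => h0 _
    simp only [u, v, if_true, if_neg hj', Pi.one_apply, one_mul]
    rw [← mul_assoc, ← mul_assoc, ← add_mul]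
    refine mul_le_mul_of_nonneg_right ?_ hr
    nlinarith [two_mul_le_add_sq (|(k.1 j : ℝ)| * a (k.1 j)) (a (k.1 j')),
      sq_nonneg (|(k.1 j : ℝ)| * a (k.1 j)), sq_nonneg (a (k.1 j'))]
  -- With no second coordinate the hyperplane is the single point 0.
  · push Not at hj
    have : Subsingleton {k : Fin ℓ → ℤ // ∑ i, k i = 0} := by
      refine ⟨fun k k' => Subtype.ext (funext fun i => ?_)⟩
      have hz : ∀ k : {k : Fin ℓ → ℤ // ∑ i, k i = 0}, k.1 j = 0 := fun k => by
        have := k.2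
        rwa [Finset.sum_eq_single j (fun b _ hb => (hb (hj b)).elim) (by simp)] at this
      rw [hj i, hz, hz]
    exact summable_of_hasFiniteSupport (Set.toFinite _)

end Hyperplane

/-! ### Path counts against weights -/

section Weights

variable {ℓ : ℕ}

/-- The sums over the first s coordinates and over the rest are opposite, so each side contributes
|P_s| to ∑|k_i|. The factor 2 lets both maxima fit under a single ∑|k_i|. -/
theorem two_mul_abs_partialSum_le {k : Fin ℓ → ℤ} (hk : ∑ i, k i = 0) (s : ℕ) :
    2 * |partialSum k s| ≤ ∑ i, |k i| := by
  have h1 := Finset.sum_filter_add_sum_filter_not Finset.univ (fun i : Fin ℓ => (i : ℕ) < s) k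
  have h2 := Finset.sum_filter_add_sum_filter_not Finset.univ (fun i : Fin ℓ => (i : ℕ) < s)
    fun i => |k i|
  have h3 := Finset.abs_sum_le_sum_abs k (Finset.univ.filter fun i : Fin ℓ => (i : ℕ) < s)
  have h4 := Finset.abs_sum_le_sum_abs k (Finset.univ.filter fun i : Fin ℓ => ¬ (i : ℕ) < s)
  rw [hk] at h1
  rw [eq_neg_of_add_eq_zero_right h1, abs_neg] at h4
  rw [partialSum]
  omega

theorem maxPartial_nonneg (c : Composition ℓ) (k : Fin ℓ → ℤ) : 0 ≤ maxPartial c k :=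
  (Finset.le_fold_max 0).2 (Or.inl le_rfl)

theorem two_mul_maxPartial_le (c : Composition ℓ) {k : Fin ℓ → ℤ} (hk : ∑ i, k i = 0) :
    2 * maxPartial c k ≤ ∑ i, |k i| := by
  have h : maxPartial c k ≤ (∑ i, |k i|) / 2 := by
    refine (Finset.fold_max_le _).2 ⟨?_, fun j _ => ?_⟩
    · have : 0 ≤ ∑ i, |k i| := Finset.sum_nonneg fun i _ => abs_nonneg _
      omega
    · have := two_mul_abs_partialSum_le hk (c.sizeUpTo j)
      have := le_abs_self (partialSum k (c.sizeUpTo j))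
      omega
  omega

/-- The part of the weight belonging to a composition. -/
noncomputable def gap (n : ℕ) (c : Composition ℓ) (k : Fin ℓ → ℤ) : ℝ :=
  (n : ℝ) - (maxPartial c k : ℝ) - (maxPartial c (fun i => -k i) : ℝ)

theorem maxPartial_add_le (c : Composition ℓ) {k : Fin ℓ → ℤ} (hk : ∑ i, k i = 0) :
    maxPartial c k + maxPartial c (fun i => -k i) ≤ ∑ i, |k i| := by
  have h1 := two_mul_maxPartial_le c hk
  have h2 := two_mul_maxPartial_le c (k := fun i => -k i) (by simp [hk])
  simp only [abs_neg] at h2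
  omega

theorem pathCount_eq_gap (n : ℕ) (c : Composition ℓ) {k : Fin ℓ → ℤ} (hk : ∑ i, k i = 0)
    (hn : ∑ i, |k i| ≤ n) : (pathCount n c k : ℝ) = gap n c k := by
  have h := maxPartial_add_le c hk
  have : ((pathCount n c k : ℕ) : ℤ) = n - maxPartial c k - maxPartial c (fun i => -k i) := by
    rw [pathCount]
    omega
  rw [gap]
  exact_mod_cast this

/-- Taking the positive part of x moves it by max(0, -x), and here -x is at most the sum of the two
maxima. -/
theorem abs_pathCount_sub_gap_le (n : ℕ) (c : Composition ℓ) {k : Fin ℓ → ℤ}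
    (hk : ∑ i, k i = 0) : |(pathCount n c k : ℝ) - gap n c k| ≤ ∑ i, |(k i : ℝ)| := by
  have h := maxPartial_add_le c hk
  have h1 := maxPartial_nonneg c k
  have h2 := maxPartial_nonneg c (fun i => -k i)
  have : |((pathCount n c k : ℕ) : ℤ) -
      (n - maxPartial c k - maxPartial c (fun i => -k i))| ≤ ∑ i, |k i| := by
    rw [pathCount, abs_le]
    omega
  rw [gap]
  exact_mod_cast this

theorem abs_gap_le (n : ℕ) (c : Composition ℓ) {k : Fin ℓ → ℤ}
    (hk : ∑ i, k i = 0) : |gap n c k| ≤ n + ∑ i, |(k i : ℝ)| := by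
  have h := maxPartial_add_le c hk
  have h1 := maxPartial_nonneg c k
  have h2 := maxPartial_nonneg c (fun i => -k i)
  have : |((n : ℤ) - maxPartial c k - maxPartial c (fun i => -k i))| ≤ n + ∑ i, |k i| := by
    rw [abs_le]
    omega
  rw [gap]
  exact_mod_cast this

/-- The coefficient of a composition in the expansion of the cumulant. -/
noncomputable def compCoeff (c : Composition ℓ) : ℝ :=
  (-1 : ℝ) ^ (c.length - 1) / (c.length : ℝ) *
    ((ℓ.factorial : ℝ) / ∏ i : Fin c.length, ((c.blocksFun i).factorial : ℝ))

theorem weight_eq_sum (hℓ : 1 ≤ ℓ) (n : ℕ) (k : Fin ℓ → ℤ) :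
    weight n k = ∑ c : Composition ℓ, compCoeff c * gap n c k := by
  rw [weight, ← Finset.sum_fiberwise_of_maps_to (t := Finset.Icc 1 ℓ)
    (g := fun c : Composition ℓ => c.length)]
  · refine Finset.sum_congr rfl fun m _ => ?_
    rw [Finset.mul_sum]
    refine Finset.sum_congr rfl fun c hc => ?_
    obtain rfl : c.length = m := (Finset.mem_filter.1 hc).2
    rw [compCoeff, gap, mul_assoc]
  · intro c _
    exact Finset.mem_Icc.2 ⟨c.length_pos_of_pos hℓ, c.length_le⟩

end Weights


/-! ### The final estimate -/

section Estimate

variable {ℓ : ℕ}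

/-- The `k ∈ ℤ^ℓ` with `∑ k_i = 0` and `∑ |k_i| > n`. -/
abbrev LargeHyperplane (ℓ n : ℕ) : Type :=
  {k : Fin ℓ → ℤ // ∑ i, k i = 0 ∧ (n : ℤ) < ∑ i, |k i|}

/-- The inclusion into the hyperplane `∑ k_i = 0`. -/
def LargeHyperplane.toHyperplane {n : ℕ} (k : LargeHyperplane ℓ n) :
    {k : Fin ℓ → ℤ // ∑ i, k i = 0} := ⟨k.1, k.2.1⟩

theorem LargeHyperplane.toHyperplane_injective {n : ℕ} :
    Function.Injective (LargeHyperplane.toHyperplane : LargeHyperplane ℓ n → _) :=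
  fun _ _ h => Subtype.ext (congrArg (fun k => k.1) h)

theorem summable_largeHyperplane {n : ℕ} (a : ℤ → ℝ) (j : Fin ℓ)
    (h : Summable fun k : {k : Fin ℓ → ℤ // ∑ i, k i = 0} =>
      |(k.1 j : ℝ)| * ∏ i, a (k.1 i)) :
    Summable fun k : LargeHyperplane ℓ n => |(k.1 j : ℝ)| * ∏ i, a (k.1 i) := by
  have h' := h.comp_injective (LargeHyperplane.toHyperplane_injective (n := n))
  simp only [Function.comp_def, LargeHyperplane.toHyperplane] at h'
  exact h'

/-- Permutation of the coordinates on `LargeHyperplane ℓ n`. -/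
def LargeHyperplane.perm {n : ℕ} (σ : Equiv.Perm (Fin ℓ)) :
    LargeHyperplane ℓ n ≃ LargeHyperplane ℓ n :=
  (Equiv.arrowCongr σ (Equiv.refl ℤ)).subtypeEquiv fun k => by
    have h1 := Equiv.sum_comp σ.symm k
    have h2 := Equiv.sum_comp σ.symm fun i => |k i|
    simp only [Equiv.arrowCongr_apply, Function.comp_apply, Equiv.refl_apply, h1, h2]

/-- Both the index set and the product are invariant under swapping two coordinates. -/
theorem tsum_abs_mul_prod_eq {n : ℕ} (a : ℤ → ℝ) (i j : Fin ℓ) :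
    ∑' k : LargeHyperplane ℓ n, |(k.1 j : ℝ)| * ∏ i, a (k.1 i) =
      ∑' k : LargeHyperplane ℓ n, |(k.1 i : ℝ)| * ∏ i, a (k.1 i) := by
  rw [← (LargeHyperplane.perm (Equiv.swap i j)).tsum_eq]
  refine tsum_congr fun k => ?_
  have h1 : ∀ l, (LargeHyperplane.perm (Equiv.swap i j) k).1 l = k.1 (Equiv.swap i j l) :=
    fun l => rfl
  simp only [h1, Equiv.swap_apply_right]
  rw [Equiv.prod_comp (Equiv.swap i j) fun l => a (k.1 l)]

theorem cumulant_linStat_eq_sum {n : ℕ} (hℓ : 1 ≤ ℓ) (F : C(Circ, ℂ)) :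
    cumulant (haarU n) (linStat n F) ℓ = ∑ c : Composition ℓ, (compCoeff c : ℂ) *
      ((List.ofFn fun i => toeplitz n (F ^ c.blocksFun i)).prod).trace := by
  rw [cumulant_linStat F hℓ, Finset.mul_sum]
  refine Finset.sum_congr rfl fun c _ => ?_
  rw [compCoeff]
  push_cast
  ring

/-- The cumulant and the main term are series over the same hyperplane, so they are compared term by
term. The differences vanish when ∑|k_i| ≤ n and otherwise cost at most K ∑_j |k_j|; the ℓ sums over
j are equal by symmetry, whence the factor ℓ. -/
theorem norm_cumulant_sub_tsum_le (hℓ : 1 ≤ ℓ) (n : ℕ) (F : C(Circ, ℂ))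
    (hF : Summable (fourierCoeff F))
    (hS : ∀ j, Summable fun k : {k : Fin ℓ → ℤ // ∑ i, k i = 0} =>
      |(k.1 j : ℝ)| * ∏ i, ‖fourierCoeff F (k.1 i)‖) :
    Summable (fun k : {k : Fin ℓ → ℤ // ∑ i, k i = 0} =>
      (∏ i, fourierCoeff F (k.1 i)) * (weight n k.1 : ℂ)) ∧
    ‖cumulant (haarU n) (linStat n F) ℓ - ∑' k : {k : Fin ℓ → ℤ // ∑ i, k i = 0},
        (∏ i, fourierCoeff F (k.1 i)) * (weight n k.1 : ℂ)‖ ≤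
      ((∑ c : Composition ℓ, |compCoeff c|) * ℓ) * ∑' k : LargeHyperplane ℓ n,
        |(k.1 ⟨0, hℓ⟩ : ℝ)| * ∏ i, ‖fourierCoeff F (k.1 i)‖ := by
  set K : ℝ := ∑ c : Composition ℓ, |compCoeff c| with hK
  have hP : Summable fun k : {k : Fin ℓ → ℤ // ∑ i, k i = 0} =>
      ∏ i, ‖fourierCoeff F (k.1 i)‖ :=
    (summable_prod_of_summable (u := fun _ k => ‖fourierCoeff F k‖) fun _ => hF.norm).comp_injective
      Subtype.val_injective
  have hA : Summable fun k : {k : Fin ℓ → ℤ // ∑ i, k i = 0} =>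
      (∑ j, |(k.1 j : ℝ)|) * ∏ i, ‖fourierCoeff F (k.1 i)‖ := by
    simp only [Finset.sum_mul]
    exact summable_sum fun j _ => hS j
  have hW : Summable fun k : {k : Fin ℓ → ℤ // ∑ i, k i = 0} =>
      (∏ i, fourierCoeff F (k.1 i)) * (weight n k.1 : ℂ) := by
    refine Summable.of_norm_bounded ((hP.mul_left (K * n)).add (hA.mul_left K)) fun k => ?_
    rw [norm_mul, norm_prod, Complex.norm_real, Real.norm_eq_abs, weight_eq_sum hℓ]
    have h1 : |∑ c : Composition ℓ, compCoeff c * gap n c k.1| ≤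
        K * (n + ∑ j, |(k.1 j : ℝ)|) := by
      refine (Finset.abs_sum_le_sum_abs _ _).trans ?_
      rw [hK, Finset.sum_mul]
      refine Finset.sum_le_sum fun c _ => ?_
      rw [abs_mul]
      exact mul_le_mul_of_nonneg_left (abs_gap_le n c k.2) (abs_nonneg _)
    refine (mul_le_mul_of_nonneg_left h1 (by positivity)).trans (le_of_eq ?_)
    ring
  refine ⟨hW, ?_⟩
  have hC : HasSum (fun k : {k : Fin ℓ → ℤ // ∑ i, k i = 0} => ∑ c : Composition ℓ,
      (compCoeff c : ℂ) * ((∏ i, fourierCoeff F (k.1 i)) * (pathCount n c k.1 : ℂ)))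
      (cumulant (haarU n) (linStat n F) ℓ) := by
    rw [cumulant_linStat_eq_sum hℓ]
    exact hasSum_sum fun c _ => (hasSum_trace_prod_toeplitz F hF c).mul_left _
  have hD := hC.sub hW.hasSum
  have hfun : ∀ k : {k : Fin ℓ → ℤ // ∑ i, k i = 0}, (∑ c : Composition ℓ,
      (compCoeff c : ℂ) * ((∏ i, fourierCoeff F (k.1 i)) * (pathCount n c k.1 : ℂ))) -
        (∏ i, fourierCoeff F (k.1 i)) * (weight n k.1 : ℂ) =
      (∏ i, fourierCoeff F (k.1 i)) *
        ((∑ c : Composition ℓ, compCoeff c * (pathCount n c k.1 - gap n c k.1) : ℝ) : ℂ) := by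
    intro k
    rw [weight_eq_sum hℓ]
    push_cast
    rw [Finset.mul_sum, Finset.mul_sum, ← Finset.sum_sub_distrib]
    refine Finset.sum_congr rfl fun c _ => ?_
    ring
  simp only [hfun] at hD
  have hsupp : ∀ k, k ∉ Set.range (LargeHyperplane.toHyperplane (ℓ := ℓ) (n := n)) →
      (∏ i, fourierCoeff F (k.1 i)) *
        ((∑ c : Composition ℓ, compCoeff c * (pathCount n c k.1 - gap n c k.1) : ℝ) : ℂ) = 0 := by
    intro k hk
    have hle : ∑ i, |k.1 i| ≤ n := by
      by_contra h
      exact hk ⟨⟨k.1, k.2, not_le.1 h⟩, rfl⟩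
    rw [Finset.sum_eq_zero, Complex.ofReal_zero, mul_zero]
    intro c _
    rw [pathCount_eq_gap n c k.2 hle, sub_self, mul_zero]
  have hL := (LargeHyperplane.toHyperplane_injective.hasSum_iff hsupp).2 hD
  simp only [Function.comp_def, LargeHyperplane.toHyperplane] at hL
  have hA' : ∀ j, Summable fun k : LargeHyperplane ℓ n =>
      |(k.1 j : ℝ)| * ∏ i, ‖fourierCoeff F (k.1 i)‖ := fun j =>
    summable_largeHyperplane (fun k => ‖fourierCoeff F k‖) j (hS j)
  have hB : HasSum (fun k : LargeHyperplane ℓ n =>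
      K * ∑ j, |(k.1 j : ℝ)| * ∏ i, ‖fourierCoeff F (k.1 i)‖)
      (K * ∑ _j : Fin ℓ, ∑' k : LargeHyperplane ℓ n,
        |(k.1 ⟨0, hℓ⟩ : ℝ)| * ∏ i, ‖fourierCoeff F (k.1 i)‖) := by
    refine (hasSum_sum fun j _ => ?_).mul_left K
    rw [← tsum_abs_mul_prod_eq (fun k => ‖fourierCoeff F k‖) ⟨0, hℓ⟩ j]
    exact (hA' j).hasSum
  rw [Finset.sum_const, Finset.card_univ, Fintype.card_fin, nsmul_eq_mul, ← mul_assoc] at hB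
  rw [← hL.tsum_eq]
  refine tsum_of_norm_bounded hB fun k => ?_
  rw [norm_mul, norm_prod, Complex.norm_real, Real.norm_eq_abs,
    ← Finset.sum_mul, ← mul_assoc, mul_comm]
  refine mul_le_mul_of_nonneg_right ?_ (by positivity)
  refine (Finset.abs_sum_le_sum_abs _ _).trans ?_
  rw [hK, Finset.sum_mul]
  refine Finset.sum_le_sum fun c _ => ?_
  rw [abs_mul]
  exact mul_le_mul_of_nonneg_left (abs_pathCount_sub_gap_le n c k.2.1) (abs_nonneg _)

end Estimate

end UnitaryCumulant

theorem lemma1 (ℓ : ℕ) (hℓ : 1 ≤ ℓ) :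
    ∃ K : ℝ, ∀ (n : ℕ) (f : AddCircle (2 * Real.pi) → ℂ),
      ContDiff ℝ 1 (fun x : ℝ => f (x : AddCircle (2 * Real.pi))) →
      Summable (fun k : {k : Fin ℓ → ℤ // ∑ i, k i = 0} =>
        (∏ i, fourierCoeff f (k.1 i)) * (UnitaryCumulant.weight n k.1 : ℂ)) ∧
      Summable (fun k : {k : Fin ℓ → ℤ // ∑ i, k i = 0 ∧ (n : ℤ) < ∑ i, |k i|} =>
        |(k.1 ⟨0, hℓ⟩ : ℝ)| * ∏ i, ‖fourierCoeff f (k.1 i)‖) ∧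
      ‖UnitaryCumulant.cumulant (UnitaryCumulant.haarU n) (UnitaryCumulant.linStat n f) ℓ -
          ∑' k : {k : Fin ℓ → ℤ // ∑ i, k i = 0},
            (∏ i, fourierCoeff f (k.1 i)) * (UnitaryCumulant.weight n k.1 : ℂ)‖ ≤
        K * ∑' k : {k : Fin ℓ → ℤ // ∑ i, k i = 0 ∧ (n : ℤ) < ∑ i, |k i|},
          |(k.1 ⟨0, hℓ⟩ : ℝ)| * ∏ i, ‖fourierCoeff f (k.1 i)‖ := by
  refine ⟨(∑ c : Composition ℓ, |UnitaryCumulant.compCoeff c|) * ℓ, fun n f hf => ?_⟩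
  have hsum := UnitaryCumulant.summable_norm_fourierCoeff hf
  have hS := UnitaryCumulant.summable_abs_mul_prod_hyperplane (ℓ := ℓ)
    (a := fun k => ‖fourierCoeff f k‖) (fun _ => norm_nonneg _) hsum (UnitaryCumulant.summable_sq_mul_fourierCoeff hf)
  obtain ⟨h1, h2⟩ := UnitaryCumulant.norm_cumulant_sub_tsum_le hℓ n
    ⟨f, UnitaryCumulant.continuous_of_contDiff hf⟩ hsum.of_norm hS
  exact ⟨h1, UnitaryCumulant.summable_largeHyperplane (fun k => ‖fourierCoeff f k‖) ⟨0, hℓ⟩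
    (hS ⟨0, hℓ⟩), h2⟩
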